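/- All rings are commutative integral domains. For a domain $R$ with quotient field $K$, call $R$ a \emph{valuative domain} if for each $x\in K$ at least one of the extensions $R\subseteq R[x]$ and $R\subseteq R[x^{-1}]$ has no ring strictly between its two members (the two may coincide; the condition holds trivially for $x=0$). Call $R$ a \emph{maximal non valuative domain} if $R\neq K$, $R$ is not a valuative domain, but every ring $S$ with $R\subsetneq S\subseteq K$ is a valuative domain. Theorem. Let $R$ be an integrally closed domain. Then the following statements are equivalent: (1) $R$ is a maximal non valuative domain. (2) Exactly one of the following holds: (i) $R$ is a B\'ezout domain with exactly two maximal ideals, and there is exactly one unordered pair $\{P,Q\}$ of non-maximal prime ideals of $R$ that are not comparable under inclusion. (ii) $R$ is a B\'ezout domain with exactly three maximal ideals, and these can be labelled $M,N,U$ so that there is exactly one non-maximal prime ideal of $R$ that is contained in neither $M$ nor $N$, whereas $U$ contains all non-maximal prime ideals of $R$. (iii) $R$ is a B\'ezout domain with exactly four maximal ideals, and at most one maximal ideal of $R$ does not contain all non-maximal prime ideals of $R$. -/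

import Mathlib

/-- For an integral domain `R` with an extension ring `T` and `B` a ring between `R` and `T`:
there is no ring strictly between `R` and `B` (the case `B = R` is allowed). Subrings of `T`
containing `R` are the `R`-subalgebras of `T`, and `⊥` is (the image of) `R`. -/
def HasNoIntermediateRing {R T : Type*} [CommRing R] [CommRing T] [Algebra R T]
    (B : Subalgebra R T) : Prop :=
  ∀ S : Subalgebra R T, S ≤ B → S = ⊥ ∨ S = B

/-- `R` is a valuative domain: for each `x` in the quotient field, `R ⊆ R[x]` or `R ⊆ R[x⁻¹]` has
no (strictly) intermediate ring. For `x = 0` this holds trivially, as `R[0] = R`. -/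
def IsValuativeDomain (R : Type*) [CommRing R] [IsDomain R] : Prop :=
  ∀ x : FractionRing R,
    HasNoIntermediateRing (Algebra.adjoin R {x}) ∨
      HasNoIntermediateRing (Algebra.adjoin R {x⁻¹})

/-- `R` is a maximal non valuative subring of the domain `T ⊇ R`: it is a proper subring, it is not
a valuative domain, and every subring of `T` properly containing `R` is a valuative domain. -/
def IsMaximalNonValuativeSubring (R T : Type*) [CommRing R] [IsDomain R] [CommRing T] [IsDomain T]
    [Algebra R T] [FaithfulSMul R T] : Prop :=
  (⊥ : Subalgebra R T) ≠ ⊤ ∧ ¬ IsValuativeDomain R ∧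
    ∀ S : Subalgebra R T, ⊥ < S → IsValuativeDomain S

/-- `R` is a maximal non valuative domain: a maximal non valuative subring of its quotient field. -/
def IsMaximalNonValuativeDomain (R : Type*) [CommRing R] [IsDomain R] : Prop :=
  IsMaximalNonValuativeSubring R (FractionRing R)

/-- A prime ideal that is not maximal. -/
def IsNonMaximalPrime {R : Type*} [CommRing R] (P : Ideal R) : Prop :=
  P.IsPrime ∧ ¬ P.IsMaximal

/-- Bézout, exactly two maximal ideals, and exactly one (unordered) pair of incomparable
non-maximal primes. -/
def BezoutTwoMaximal (R : Type*) [CommRing R] : Prop :=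
  IsBezout R ∧ {M : Ideal R | M.IsMaximal}.ncard = 2 ∧
    ∃ P Q : Ideal R, IsNonMaximalPrime P ∧ IsNonMaximalPrime Q ∧ ¬ P ≤ Q ∧ ¬ Q ≤ P ∧
      ∀ P' Q' : Ideal R, IsNonMaximalPrime P' → IsNonMaximalPrime Q' → ¬ P' ≤ Q' → ¬ Q' ≤ P' →
        (P' = P ∧ Q' = Q) ∨ (P' = Q ∧ Q' = P)

/-- Bézout with exactly three maximal ideals `M`, `N`, `U`, where exactly one non-maximal prime is
contained in neither of `M` and `N`, while `U` contains all non-maximal primes. -/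
def BezoutThreeMaximal (R : Type*) [CommRing R] : Prop :=
  IsBezout R ∧ {M : Ideal R | M.IsMaximal}.ncard = 3 ∧
    ∃ M N U : Ideal R, M.IsMaximal ∧ N.IsMaximal ∧ U.IsMaximal ∧ M ≠ N ∧ M ≠ U ∧ N ≠ U ∧
      (∃! P : Ideal R, IsNonMaximalPrime P ∧ ¬ P ≤ M ∧ ¬ P ≤ N) ∧
      ∀ P : Ideal R, IsNonMaximalPrime P → P ≤ U

/-- Bézout with exactly four maximal ideals, at most one of which does not contain all
non-maximal primes. -/
def BezoutFourMaximal (R : Type*) [CommRing R] : Prop :=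
  IsBezout R ∧ {M : Ideal R | M.IsMaximal}.ncard = 4 ∧
    {M : Ideal R | M.IsMaximal ∧ ¬ ∀ P : Ideal R, IsNonMaximalPrime P → P ≤ M}.Subsingleton

/-- Exactly one of three propositions holds. -/
def ExactlyOneOfThree (A B C : Prop) : Prop :=
  (A ∧ ¬ B ∧ ¬ C) ∨ (¬ A ∧ B ∧ ¬ C) ∨ (¬ A ∧ ¬ B ∧ C)

/-! The proof reduces everything to the order on the primes. Let every proper overring of $R$ be
valuative. Testing $R[x^4]$ at $x$ gives a polynomial relation for $x$ with a coefficient $-1$; as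
$R$ is integrally closed, this makes $R$ locally a valuation ring. Five maximal ideals would give a
proper overring $R[1/m]$ that is not valuative, so there are at most four, and local divisibility
glues to the Bézout property.

Over a Bézout domain write $x=a/b$ with $a,b$ coprime, so that $1/b\in R[x]$. If at most one prime
contains $b$, nothing lies strictly between $R$ and $R[x]$; if two do, some divisor $d$ of $b$ lies
in exactly one of them, and $R[1/d]$ lies strictly between. Hence $R$ is non valuative exactly when
two primes over $a$ and two over $b$ can be found for some coprime nonzero $a,b$: a cross pair
(`IsCrossPair`). Primes of an overring contract to primes of $R$ with the same order, and a proper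
overring loses some maximal ideal. So $R$ is maximal non valuative iff a cross pair exists and each
one contains all maximal ideals (`IsBezout.isMaximalNonValuativeDomain_iff`).

The rest concerns the tree of primes: incomparable primes are coprime, so the primes below a given
one form a chain. A covering cross pair leaves two, three or four maximal ideals, and these counts
give (i), (ii), (iii). -/

open Polynomial

/-- A domain is locally a valuation ring: at each maximal ideal, of any two elements one divides
the other up to an element outside that ideal. -/
def LocallyTotalDvd (R : Type*) [CommRing R] : Prop :=
  ∀ M : Ideal R, M.IsMaximal → ∀ a b : R, ∃ s ∉ M, b ∣ s * a ∨ a ∣ s * b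

/-! ### Change of fraction field and clearing of denominators -/

theorem HasNoIntermediateRing.map_algEquiv {R T T' : Type*} [CommRing R] [CommRing T]
    [CommRing T'] [Algebra R T] [Algebra R T'] (e : T ≃ₐ[R] T') {B : Subalgebra R T}
    (h : HasNoIntermediateRing B) : HasNoIntermediateRing (B.map (e : T →ₐ[R] T')) := by
  intro S hS
  have key : (S.map (e.symm : T' →ₐ[R] T)).map (e : T →ₐ[R] T') = S := by
    ext x; simp
  have hle : S.map (e.symm : T' →ₐ[R] T) ≤ B := by
    rintro _ ⟨x, hx, rfl⟩
    obtain ⟨y, hy, rfl⟩ := hS hx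
    simpa using hy
  rcases h _ hle with h | h
  · left; rw [← key, h, Algebra.map_bot]
  · right; rw [← key, h]

theorem IsValuativeDomain.hasNoIntermediateRing {R : Type*} [CommRing R] [IsDomain R]
    (h : IsValuativeDomain R) (K : Type*) [Field K] [Algebra R K] [IsFractionRing R K] (x : K) :
    HasNoIntermediateRing (Algebra.adjoin R {x}) ∨
      HasNoIntermediateRing (Algebra.adjoin R {x⁻¹}) := by
  let e : FractionRing R ≃ₐ[R] K := FractionRing.algEquiv R K
  have key : ∀ y : FractionRing R, (Algebra.adjoin R {y}).map (e : FractionRing R →ₐ[R] K) =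
      Algebra.adjoin R {e y} := by
    intro y
    rw [AlgHom.map_adjoin]; simp
  rcases h (e.symm x) with h | h
  · left; simpa [key] using h.map_algEquiv e
  · right; simpa [key] using h.map_algEquiv e

/-- An element of `R[1/m]` becomes an element of `R` after multiplication by a power of `m`. -/
theorem exists_pow_mul_eq_of_mem_adjoin_inv {R K : Type*} [CommRing R] [Field K] [Algebra R K]
    {m : R} (hm : algebraMap R K m ≠ 0) {y : K}
    (hy : y ∈ Algebra.adjoin R {(algebraMap R K m)⁻¹}) :
    ∃ (k : ℕ) (r : R), algebraMap R K m ^ k * y = algebraMap R K r := by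
  induction hy using Algebra.adjoin_induction with
  | mem x hx =>
    refine ⟨1, 1, ?_⟩
    rw [Set.mem_singleton_iff.mp hx]; simp [hm]
  | algebraMap r => exact ⟨0, r, by simp⟩
  | add x y _ _ hx hy =>
    obtain ⟨k, r, h⟩ := hx
    obtain ⟨l, s, h'⟩ := hy
    refine ⟨k + l, m ^ l * r + m ^ k * s, ?_⟩
    rw [map_add, map_mul, map_mul, ← h, ← h', map_pow, map_pow]; ring
  | mul x y _ _ hx hy =>
    obtain ⟨k, r, h⟩ := hx
    obtain ⟨l, s, h'⟩ := hy
    refine ⟨k + l, r * s, ?_⟩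
    rw [map_mul, ← h, ← h']; ring

/-! ### Local divisibility from relations with a unit coefficient -/

/-- If a root of a polynomial with a coefficient outside the prime `M` lies in the fraction field of
an integrally closed domain, then it or its inverse has a denominator outside `M`. -/
theorem exists_mul_mem_of_coeff_notMem {R K : Type*} [CommRing R] [IsDomain R]
    [IsIntegrallyClosed R] [Field K] [Algebra R K] [IsFractionRing R K] {M : Ideal R}
    [M.IsPrime] {x : K} (hx : x ≠ 0) :
    ∀ (n : ℕ) (p : R[X]), p.natDegree ≤ n → aeval x p = 0 → (∃ k, p.coeff k ∉ M) →
      ∃ s ∉ M, ∃ r : R, algebraMap R K s * x = algebraMap R K r ∨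
        algebraMap R K s * x⁻¹ = algebraMap R K r := by
  intro n
  induction n with
  | zero =>
    rintro p hp h0 ⟨k, hk⟩
    rw [Polynomial.eq_C_of_natDegree_le_zero hp] at h0 hk
    rw [aeval_C, map_eq_zero_iff _ (IsFractionRing.injective R K)] at h0
    simp [h0] at hk
  | succ n ih =>
    rintro p hp h0 ⟨k, hk⟩
    by_cases hn : p.natDegree ≤ n
    · exact ih p hn h0 ⟨k, hk⟩
    have hd : p.natDegree = n + 1 := by omega
    obtain ⟨y, hy⟩ := IsIntegrallyClosed.isIntegral_iff.mp (isIntegral_leadingCoeff_smul p x h0)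
    rw [Algebra.smul_def] at hy
    by_cases hc : p.leadingCoeff ∈ M
    swap
    · exact ⟨_, hc, y, Or.inl hy.symm⟩
    by_cases hyM : y ∈ M
    swap
    · refine ⟨y, hyM, p.leadingCoeff, Or.inr ?_⟩
      rw [hy]; field_simp
    -- With $c$ the leading coefficient and $y=cx\in R$, replace $cx^{n+1}$ by $yx^n$. As $c,y\in
    -- M$, the coefficient outside $M$ survives modulo $M$.
    refine ih (p.eraseLead + monomial n y) ?_ ?_ ⟨k, ?_⟩
    · refine natDegree_add_le_of_degree_le ?_ (natDegree_monomial_le _)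
      have := eraseLead_natDegree_le p
      omega
    · have h1 := p.eraseLead_add_monomial_natDegree_leadingCoeff
      rw [← h1, map_add, aeval_monomial, hd] at h0
      rw [map_add, aeval_monomial, hy, ← h0]
      ring
    · have hkd : k ≠ p.natDegree := by
        rintro rfl; exact hk hc
      rw [coeff_add, eraseLead_coeff_of_ne _ hkd, coeff_monomial]
      intro h
      split_ifs at h
      · exact hk ((Submodule.add_mem_iff_left _ hyM).mp h)
      · exact hk (by simpa using h)

theorem exists_pow_mul_eq_aeval_sq {R K : Type*} [CommRing R] [Field K] [Algebra R K]
    {z : K} (hz : z ≠ 0) {y : K} (hy : y ∈ Algebra.adjoin R {z ^ 2, (z ^ 2)⁻¹}) :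
    ∃ (k : ℕ) (f : R[X]), z ^ (2 * k) * y = aeval (z ^ 2) f := by
  induction hy using Algebra.adjoin_induction with
  | mem x hx =>
    rcases hx with rfl | hx
    · exact ⟨0, X, by simp⟩
    · rw [Set.mem_singleton_iff] at hx
      refine ⟨1, 1, ?_⟩
      rw [hx]; simp [hz]
  | algebraMap r => exact ⟨0, C r, by simp⟩
  | add x y _ _ hx hy =>
    obtain ⟨k, r, h⟩ := hx
    obtain ⟨l, s, h'⟩ := hy
    refine ⟨k + l, X ^ l * r + X ^ k * s, ?_⟩
    simp only [map_add, map_mul, ← h, ← h', map_pow, aeval_X]; ring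
  | mul x y _ _ hx hy =>
    obtain ⟨k, r, h⟩ := hx
    obtain ⟨l, s, h'⟩ := hy
    refine ⟨k + l, r * s, ?_⟩
    rw [map_mul, ← h, ← h']; ring

/-- If `z` or `z⁻¹` lies in `R[z², z⁻²]`, then `z` is a root of a polynomial with a coefficient
`-1`. -/
theorem exists_aeval_eq_zero_of_mem_adjoin_sq {R K : Type*} [CommRing R] [Field K] [Algebra R K]
    {z : K} (hz : z ≠ 0) (h : z ∈ Algebra.adjoin R {z ^ 2, (z ^ 2)⁻¹} ∨
      z⁻¹ ∈ Algebra.adjoin R {z ^ 2, (z ^ 2)⁻¹}) :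
    ∃ p : R[X], aeval z p = 0 ∧ ∃ k, p.coeff k = -1 := by
  rcases h with h | h <;> obtain ⟨k, f, hf⟩ := exists_pow_mul_eq_aeval_sq hz h
  -- Parity prevents cancellation: `expand R 2 f` has only even exponents, and its product with `X`
  -- below only odd ones.
  · refine ⟨expand R 2 f - X ^ (2 * k + 1), ?_, 2 * k + 1, ?_⟩
    · simp [← hf, expand_aeval, pow_succ z (2 * k)]
    · rw [coeff_sub, coeff_expand two_pos, if_neg (by omega)]; simp
  · refine ⟨expand R 2 f * X - X ^ (2 * k), ?_, 2 * k, ?_⟩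
    · simp [← hf, expand_aeval, hz]
    · rcases k with _ | k
      · simp
      · rw [coeff_sub, show 2 * (k + 1) = (2 * k + 1) + 1 by ring, coeff_mul_X,
          coeff_expand two_pos, if_neg (by omega)]; simp

/-- If no ring lies strictly between `S` and `S[z]`, then `z² ∈ S` or `z ∈ S[z²]`. -/
theorem HasNoIntermediateRing.sq_mem_or_mem {S K : Type*} [CommRing S] [CommRing K] [Algebra S K]
    {z : K} (h : HasNoIntermediateRing (Algebra.adjoin S {z})) :
    z ^ 2 ∈ (⊥ : Subalgebra S K) ∨ z ∈ Algebra.adjoin S {z ^ 2} := by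
  have hz := Algebra.self_mem_adjoin_singleton S z
  rcases h (Algebra.adjoin S {z ^ 2})
    (Algebra.adjoin_le (by simpa using Subalgebra.pow_mem _ hz 2)) with h | h
  · exact Or.inl (h ▸ Algebra.self_mem_adjoin_singleton S (z ^ 2))
  · exact Or.inr (h ▸ hz)

theorem mem_of_mem_adjoin_subalgebra {R K : Type*} [CommRing R] [CommRing K] [Algebra R K]
    {S B : Subalgebra R K} (hS : S ≤ B) {t y : K} (ht : t ∈ B)
    (hy : y ∈ Algebra.adjoin S {t}) : y ∈ B := by
  induction hy using Algebra.adjoin_induction with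
  | mem x hx => rwa [Set.mem_singleton_iff.mp hx]
  | algebraMap r => exact hS r.2
  | add x y _ _ hx hy => exact add_mem hx hy
  | mul x y _ _ hx hy => exact mul_mem hx hy

/-- Put $S=R[x^4]$. Valuativity at $x$ gives, for $z=x$ or $z=x^{-1}$, either $z^2\in S$ or $z\in
S[z^2]$. The fourth power serves both cases: $S$ lies in $R[x^2,x^{-2}]$ and also in $R[w^2,w^{-2}]$
for $w=x^2$, so the parity argument applies to $x$ or to $w$. -/
theorem exists_aeval_eq_zero_of_overrings_valuative {R K : Type*} [CommRing R] [IsDomain R]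
    [IsIntegrallyClosed R] [Field K] [Algebra R K] [IsFractionRing R K]
    (h : ∀ S : Subalgebra R K, ⊥ < S → IsValuativeDomain S) {x : K} (hx : x ≠ 0) :
    ∃ p : R[X], aeval x p = 0 ∧ ∃ k, p.coeff k = -1 := by
  let S := Algebra.adjoin R {x ^ 4}
  have h4 : x ^ 4 ∈ S := Algebra.self_mem_adjoin_singleton R _
  by_cases hS : S = ⊥
  · rw [hS] at h4
    obtain ⟨r, hr⟩ := Algebra.mem_bot.mp h4
    exact ⟨C r - X ^ 4, by simp [hr], 4, by simp⟩
  have hle : ∀ z : K, x ^ 4 ∈ Algebra.adjoin R {z ^ 2, (z ^ 2)⁻¹} →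
      S ≤ Algebra.adjoin R {z ^ 2, (z ^ 2)⁻¹} := fun z hz => Algebra.adjoin_le (by simpa using hz)
  have h1 : S ≤ Algebra.adjoin R {x ^ 2, (x ^ 2)⁻¹} := by
    refine hle x ?_
    rw [show x ^ 4 = (x ^ 2) ^ 2 by ring]
    exact Subalgebra.pow_mem _ (Algebra.subset_adjoin (by simp)) 2
  have h2 : S ≤ Algebra.adjoin R {(x ^ 2) ^ 2, ((x ^ 2) ^ 2)⁻¹} := by
    refine hle (x ^ 2) ?_
    rw [show x ^ 4 = (x ^ 2) ^ 2 by ring]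
    exact Algebra.subset_adjoin (by simp)
  have of_sq : (x ^ 2 ∈ S ∨ (x ^ 2)⁻¹ ∈ S) →
      ∃ p : R[X], aeval x p = 0 ∧ ∃ k, p.coeff k = -1 := by
    intro h
    obtain ⟨p, hp, k, hk⟩ := exists_aeval_eq_zero_of_mem_adjoin_sq (R := R) (pow_ne_zero 2 hx)
      (h.imp (fun h => h2 h) (fun h => h2 h))
    exact ⟨expand R 2 p, by rwa [expand_aeval], k * 2, by rw [coeff_expand_mul two_pos, hk]⟩
  have mem_bot : ∀ y : K, y ∈ (⊥ : Subalgebra S K) → y ∈ S := by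
    intro y hy
    obtain ⟨r, rfl⟩ := Algebra.mem_bot.mp hy
    exact r.2
  rcases (h S (bot_lt_iff_ne_bot.mpr hS)).hasNoIntermediateRing K x with h | h
  · rcases h.sq_mem_or_mem with h | h
    · exact of_sq (Or.inl (mem_bot _ h))
    · exact exists_aeval_eq_zero_of_mem_adjoin_sq hx
        (Or.inl (mem_of_mem_adjoin_subalgebra h1 (Algebra.subset_adjoin (by simp)) h))
  · rcases h.sq_mem_or_mem with h | h
    · exact of_sq (Or.inr (by simpa using mem_bot _ h))
    · exact exists_aeval_eq_zero_of_mem_adjoin_sq hx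
        (Or.inr (mem_of_mem_adjoin_subalgebra h1 (Algebra.subset_adjoin (by simp)) h))

theorem locallyTotalDvd_of_overrings_valuative {R K : Type*} [CommRing R] [IsDomain R]
    [IsIntegrallyClosed R] [Field K] [Algebra R K] [IsFractionRing R K]
    (h : ∀ S : Subalgebra R K, ⊥ < S → IsValuativeDomain S) : LocallyTotalDvd R := by
  intro M hM a b
  have h1 : (1 : R) ∉ M := (Ideal.ne_top_iff_one M).mp hM.ne_top
  have := hM.isPrime
  have inj := IsFractionRing.injective R K
  by_cases ha : a = 0
  · exact ⟨1, h1, Or.inl (by simp [ha])⟩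
  by_cases hb : b = 0
  · exact ⟨1, h1, Or.inr (by simp [hb])⟩
  have ha' : algebraMap R K a ≠ 0 := by simpa using ha
  have hb' : algebraMap R K b ≠ 0 := by simpa using hb
  obtain ⟨p, hp, k, hk⟩ := exists_aeval_eq_zero_of_overrings_valuative h (div_ne_zero ha' hb')
  obtain ⟨s, hs, r, hr⟩ := exists_mul_mem_of_coeff_notMem (M := M) (div_ne_zero ha' hb') _ p le_rfl
    hp ⟨k, by rw [hk]; simpa using h1⟩
  refine ⟨s, hs, hr.imp ?_ ?_⟩ <;> intro hr <;> refine ⟨r, inj ?_⟩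
  · rw [map_mul, map_mul, ← hr]; field_simp
  · rw [map_mul, map_mul, ← hr]; field_simp

/-! ### Gluing local divisibility to the Bézout property -/

/-- A domain with finitely many maximal ideals that is locally a valuation ring is Bézout. -/
theorem LocallyTotalDvd.isBezout {R : Type*} [CommRing R] (h : LocallyTotalDvd R)
    (hfin : {M : Ideal R | M.IsMaximal}.Finite) : IsBezout R := by
  rw [IsBezout.iff_span_pair_isPrincipal]
  intro a b
  -- Choose $t+u=1$ with $t$ in every ideal of `I`, where $a$ divides $b$ locally, and $u$ in every
  -- ideal of `J`, where $b$ divides $a$ strictly. Then $a+tb$ is locally an associate of $a$ at `I`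
  -- and of $b$ at `J`, hence a generator.
  let I : Set (Ideal R) := {M | M.IsMaximal ∧ ∃ s ∉ M, a ∣ s * b}
  let J : Set (Ideal R) := {M | M.IsMaximal ∧ ¬ ∃ s ∉ M, a ∣ s * b}
  have hI : I.Finite := hfin.subset fun M hM => hM.1
  have hJ : J.Finite := hfin.subset fun M hM => hM.1
  have hcop : IsCoprime (⨅ M ∈ hI.toFinset, M) (⨅ M ∈ hJ.toFinset, M) := by
    refine Ideal.isCoprime_biInf fun M hM => IsCoprime.symm <| Ideal.isCoprime_biInf fun N hN => ?_
    rw [Set.Finite.mem_toFinset] at hM hN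
    rw [Ideal.isCoprime_iff_sup_eq]
    refine Ideal.IsMaximal.coprime_of_ne hM.1 hN.1 ?_
    rintro rfl
    exact hM.2 hN.2
  obtain ⟨t, ht, u, hu, htu⟩ := Ideal.isCoprime_iff_exists.mp hcop
  simp only [Ideal.mem_iInf, Set.Finite.mem_toFinset] at ht hu
  have key : ∀ M : Ideal R, M.IsMaximal → ∃ s ∉ M, a + t * b ∣ s * a ∧ a + t * b ∣ s * b := by
    intro M hM
    have hMp := hM.isPrime
    by_cases hs : ∃ s ∉ M, a ∣ s * b
    · have htM := ht M ⟨hM, hs⟩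
      obtain ⟨s, hs, c, hc⟩ := hs
      refine ⟨s * (s + t * c), ?_, ⟨s * s, by linear_combination (-s * t) * hc⟩,
        ⟨s * c, by linear_combination (s + t * c) * hc - t * c * hc⟩⟩
      intro hmem
      rcases hMp.mem_or_mem hmem with h | h
      · exact hs h
      · exact hs ((Submodule.add_mem_iff_left _ (M.mul_mem_right _ htM)).mp h)
    · have huM := hu M ⟨hM, hs⟩
      have htM : t ∉ M := by
        intro htM
        exact hMp.one_notMem (htu ▸ add_mem htM huM)
      obtain ⟨s, hsM, ⟨c, hc⟩ | hd⟩ := h M hM a b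
      swap
      · exact absurd ⟨s, hsM, hd⟩ hs
      have hcM : c ∈ M := by
        by_contra hcM
        exact hs ⟨c, hcM, s, by linear_combination -hc⟩
      refine ⟨s * (c + s * t), ?_, ⟨s * c, by linear_combination (c + s * t) * hc - c * hc⟩,
        ⟨s * s, by linear_combination (-s) * hc⟩⟩
      intro hmem
      rcases hMp.mem_or_mem hmem with h | h
      · exact hsM h
      · rcases hMp.mem_or_mem ((Submodule.add_mem_iff_right _ hcM).mp h) with h | h
        · exact hsM h
        · exact htM h
  -- Divisibility is local: the ideal of all $r$ with $a+tb\mid ry$ lies in no maximal ideal.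
  have dvd_of : ∀ y : R, (∀ M : Ideal R, M.IsMaximal → ∃ s ∉ M, a + t * b ∣ s * y) →
      a + t * b ∣ y := by
    intro y hy
    let C : Ideal R := Submodule.comap (LinearMap.mulRight R y) (Ideal.span {a + t * b})
    have hC : ∀ r, r ∈ C ↔ a + t * b ∣ r * y := fun r => by
      simp [C, Ideal.mem_span_singleton]
    by_cases htop : C = ⊤
    · simpa using (hC 1).mp (htop ▸ Submodule.mem_top)
    · obtain ⟨M, hM, hCM⟩ := Ideal.exists_le_maximal C htop
      obtain ⟨s, hs, hd⟩ := hy M hM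
      exact absurd (hCM ((hC s).mpr hd)) hs
  refine ⟨a + t * b, le_antisymm ?_ ?_⟩
  · refine Ideal.span_le.mpr ?_
    rintro y (rfl | hy)
    · exact Ideal.mem_span_singleton.mpr
        (dvd_of _ fun M hM => (key M hM).imp fun s hs => ⟨hs.1, hs.2.1⟩)
    · rw [Set.mem_singleton_iff] at hy
      subst hy
      exact Ideal.mem_span_singleton.mpr
        (dvd_of _ fun M hM => (key M hM).imp fun s hs => ⟨hs.1, hs.2.2⟩)
  · refine (Ideal.span_singleton_le_iff_mem _).mpr ?_
    exact add_mem (Ideal.subset_span (by simp))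
      (Ideal.mul_mem_left _ _ (Ideal.subset_span (by simp)))

/-! ### Non-valuative domains -/

/-- If `c ∣ b` is a nonunit and `b` divides no power of `c`, then `S[1/c]` lies strictly between `S`
and any ring of the form `S[x]` that contains `1/b`. -/
theorem not_hasNoIntermediateRing_of_inv_mem {S L : Type*} [CommRing S] [IsDomain S] [Field L]
    [Algebra S L] [IsFractionRing S L] {B : Subalgebra S L} {b c : S} (hb : b ≠ 0) (hcb : c ∣ b)
    (hc : ¬ IsUnit c) (hbc : ∀ n, ¬ b ∣ c ^ n) (hB : (algebraMap S L b)⁻¹ ∈ B) :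
    ¬ HasNoIntermediateRing B := by
  intro h
  have inj := IsFractionRing.injective S L
  obtain ⟨d, rfl⟩ := hcb
  have hc0 : algebraMap S L c ≠ 0 := by simpa using left_ne_zero_of_mul hb
  have hd0 : algebraMap S L d ≠ 0 := by simpa using right_ne_zero_of_mul hb
  have hle : Algebra.adjoin S {(algebraMap S L c)⁻¹} ≤ B := by
    refine Algebra.adjoin_le (Set.singleton_subset_iff.mpr ?_)
    have := mul_mem (algebraMap_mem B d) hB
    rwa [map_mul, show algebraMap S L d * (algebraMap S L c * algebraMap S L d)⁻¹ =
      (algebraMap S L c)⁻¹ by field_simp] at this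
  rcases h _ hle with h | h
  · have := Algebra.self_mem_adjoin_singleton S (algebraMap S L c)⁻¹
    rw [h] at this
    obtain ⟨r, hr⟩ := Algebra.mem_bot.mp this
    refine hc (IsUnit.of_mul_eq_one r (inj ?_))
    rw [map_mul, hr, map_one, mul_inv_cancel₀ hc0]
  · rw [← h] at hB
    obtain ⟨k, r, hr⟩ := exists_pow_mul_eq_of_mem_adjoin_inv hc0 hB
    refine hbc k ⟨r, inj ?_⟩
    rw [map_mul, ← hr, map_mul, map_pow]
    field_simp

/-- Test $x=a/b$. With $v(a+b)=1$ one has $1/b=v(x+1)\in S[x]$ and symmetrically $1/a\in S[x^{-1}]$,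
so $S[1/d]$ and $S[1/c]$ are strictly intermediate. -/
theorem not_isValuativeDomain_of_isUnit_add {S : Type*} [CommRing S] [IsDomain S] {a b c d : S}
    (hab : IsUnit (a + b)) (ha : a ≠ 0) (hb : b ≠ 0)
    (hca : c ∣ a) (hc : ¬ IsUnit c) (hac : ∀ n, ¬ a ∣ c ^ n)
    (hdb : d ∣ b) (hd : ¬ IsUnit d) (hbd : ∀ n, ¬ b ∣ d ^ n) : ¬ IsValuativeDomain S := by
  intro h
  let K := FractionRing S
  obtain ⟨v, hv⟩ := hab.exists_left_inv
  have inv_mem : ∀ {a b : S}, b ≠ 0 → v * (a + b) = 1 →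
      (algebraMap S K b)⁻¹ ∈ Algebra.adjoin S {algebraMap S K a / algebraMap S K b} := by
    intro a b hb hv
    have hb' : algebraMap S K b ≠ 0 := by simpa using hb
    have hv' := congrArg (algebraMap S K) hv
    simp only [map_mul, map_add, map_one] at hv'
    have := mul_mem (algebraMap_mem _ v)
      (add_mem (Algebra.self_mem_adjoin_singleton S (algebraMap S K a / algebraMap S K b))
        (one_mem _))
    convert this using 1
    rw [div_add_one hb', ← mul_div_assoc, hv', one_div]
  rcases h (algebraMap S K a / algebraMap S K b) with h | h
  · exact not_hasNoIntermediateRing_of_inv_mem hb hdb hd hbd (inv_mem hb hv) h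
  · rw [inv_div] at h
    exact not_hasNoIntermediateRing_of_inv_mem ha hca hc hac (inv_mem ha (by rwa [add_comm b a])) h

/-- Elements separating two primes produce a non-valuative overring `R[1/m]`. -/
theorem not_isValuativeDomain_adjoin_inv {R K : Type*} [CommRing R] [IsDomain R] [Field K]
    [Algebra R K] [IsFractionRing R K] {p₁ p₂ q₁ q₂ : Ideal R} [p₁.IsPrime] [p₂.IsPrime]
    [q₁.IsPrime] [q₂.IsPrime] {a b c d m : R} (ha : a ≠ 0) (hb : b ≠ 0) (hm : a + b ∣ m)
    (hca : c ∣ a) (hc : c ∈ p₁) (hc' : c ∉ p₂) (ha2 : a ∈ p₂)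
    (hdb : d ∣ b) (hd : d ∈ q₁) (hd' : d ∉ q₂) (hb2 : b ∈ q₂)
    (hp₁ : m ∉ p₁) (hp₂ : m ∉ p₂) (hq₁ : m ∉ q₁) (hq₂ : m ∉ q₂) :
    ¬ IsValuativeDomain (Algebra.adjoin R {(algebraMap R K m)⁻¹}) := by
  have inj := IsFractionRing.injective R K
  have hm0 : m ≠ 0 := fun h => hp₁ (h ▸ zero_mem _)
  have hm0' : algebraMap R K m ≠ 0 := by simpa using hm0
  set S := Algebra.adjoin R {(algebraMap R K m)⁻¹}
  have clear : ∀ s : S, ∃ (k : ℕ) (r : R), algebraMap R K m ^ k * s = algebraMap R K r :=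
    fun s => exists_pow_mul_eq_of_mem_adjoin_inv hm0' s.2
  have coe : ∀ r : R, ((algebraMap R S r : S) : K) = algebraMap R K r := fun r => rfl
  have injS : Function.Injective (algebraMap R S) := fun x y h =>
    inj (by rw [← coe, ← coe, h])
  have not_dvd : ∀ {x y : R} {p : Ideal R}, p.IsPrime → x ∈ p → y ∉ p → m ∉ p →
      ∀ n, ¬ algebraMap R S x ∣ algebraMap R S y ^ n := by
    rintro x y p hp hx hy hmp n ⟨s, hs⟩
    obtain ⟨k, r, hr⟩ := clear s
    have hs' := congrArg (Subtype.val : S → K) hs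
    have : m ^ k * y ^ n = x * r := by
      apply inj
      rw [map_mul, map_mul, ← hr, map_pow, map_pow]
      simp only [Subalgebra.coe_mul, Subalgebra.coe_pow, coe] at hs'
      rw [hs']; ring
    rcases hp.mem_or_mem (this ▸ p.mul_mem_right r hx : m ^ k * y ^ n ∈ p) with h | h
    · exact hmp (hp.mem_of_pow_mem _ h)
    · exact hy (hp.mem_of_pow_mem _ h)
  have not_unit : ∀ {x : R} {p : Ideal R}, p.IsPrime → x ∈ p → m ∉ p →
      ¬ IsUnit (algebraMap R S x) := by
    intro x p hp hx hmp h
    refine not_dvd hp hx ((Ideal.ne_top_iff_one p).mp hp.ne_top) hmp 1 ?_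
    simpa using h.dvd
  have hmu : IsUnit (algebraMap R S m) := by
    refine IsUnit.of_mul_eq_one ⟨_, Algebra.self_mem_adjoin_singleton R (algebraMap R K m)⁻¹⟩ ?_
    apply Subtype.ext
    simp [hm0', coe]
  refine not_isValuativeDomain_of_isUnit_add (a := algebraMap R S a) (b := algebraMap R S b)
    (c := algebraMap R S c) (d := algebraMap R S d) ?_ ?_ ?_ (map_dvd _ hca)
    (not_unit ‹p₁.IsPrime› hc hp₁) (not_dvd ‹p₂.IsPrime› ha2 hc' hp₂) (map_dvd _ hdb)
    (not_unit ‹q₁.IsPrime› hd hq₁) (not_dvd ‹q₂.IsPrime› hb2 hd' hq₂)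
  · rw [← map_add]
    exact isUnit_of_dvd_unit (map_dvd _ hm) hmu
  · rwa [Ne, map_eq_zero_iff _ injS]
  · rwa [Ne, map_eq_zero_iff _ injS]

theorem bot_lt_adjoin_inv {R K : Type*} [CommRing R] [IsDomain R] [Field K] [Algebra R K]
    [IsFractionRing R K] {m : R} (hm0 : m ≠ 0) (hm : ¬ IsUnit m) :
    ⊥ < Algebra.adjoin R {(algebraMap R K m)⁻¹} := by
  refine bot_lt_iff_ne_bot.mpr fun h => hm ?_
  have := Algebra.self_mem_adjoin_singleton R (algebraMap R K m)⁻¹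
  rw [h] at this
  obtain ⟨r, hr⟩ := Algebra.mem_bot.mp this
  refine IsUnit.of_mul_eq_one r (IsFractionRing.injective R K ?_)
  rw [map_mul, hr, map_one, mul_inv_cancel₀ (by simpa using hm0)]

/-- If every proper overring of `R` is valuative, then `R` has at most four maximal ideals. -/
theorem not_injective_of_overrings_valuative {R K : Type*} [CommRing R] [IsDomain R] [Field K]
    [Algebra R K] [IsFractionRing R K]
    (h : ∀ S : Subalgebra R K, ⊥ < S → IsValuativeDomain S) (M : Fin 5 → Ideal R)
    (hM : ∀ i, (M i).IsMaximal) : ¬ Function.Injective M := by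
  intro hinj
  have hp : ∀ i, (M i).IsPrime := fun i => (hM i).isPrime
  have ex : ∀ i, ∃ d ∈ M i, ∀ j, j ≠ i → d ∉ M j := by
    intro i
    by_contra hcon
    push Not at hcon
    have hsub : ((M i : Ideal R) : Set R) ⊆ ⋃ j ∈ ((Finset.univ.erase i : Finset (Fin 5)) : Set _),
        (M j : Set R) := by
      intro d hd
      obtain ⟨j, hj, hdj⟩ := hcon d hd
      exact Set.mem_biUnion (by simpa using hj) hdj
    obtain ⟨j, hj, hle⟩ :=
      (Ideal.subset_union_prime i i fun j _ _ _ => hp j).mp hsub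
    exact (Finset.mem_erase.mp hj).1 (hinj ((hM i).eq_of_le (hp j).ne_top hle)).symm
  choose d hd hd' using ex
  have hdj : ∀ i j, j ≠ i → d i ∉ M j := fun i j hij => hd' i j hij
  have nmul : ∀ i (x y : R), x ∉ M i → y ∉ M i → x * y ∉ M i :=
    fun i x y hx hy hxy => ((hp i).mem_or_mem hxy).elim hx hy
  have nadd : ∀ i (x y : R), x ∈ M i → y ∉ M i → x + y ∉ M i :=
    fun i x y hx hy hxy => hy ((Submodule.add_mem_iff_right _ hx).mp hxy)
  -- The factor `d 4` makes $m$ a nonunit, so $R[1/m]$ is proper. The other factor makes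
  -- $d_0d_1+d_2d_3$ a unit there, while the first four ideals survive.
  have hm : ∀ i, i ≠ 4 → (d 0 * d 1 + d 2 * d 3) * d 4 ∉ M i := by
    intro i hi
    refine nmul i _ _ ?_ (hdj 4 i hi)
    have h01 : (i = 0 ∨ i = 1) ∨ (i = 2 ∨ i = 3) := by omega
    rcases h01 with h01 | h01
    · refine nadd i _ _ ?_ (nmul i _ _ (hdj _ _ (by omega)) (hdj _ _ (by omega)))
      rcases h01 with rfl | rfl
      · exact Ideal.mul_mem_right _ _ (hd 0)
      · exact Ideal.mul_mem_left _ _ (hd 1)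
    · rw [add_comm]
      refine nadd i _ _ ?_ (nmul i _ _ (hdj _ _ (by omega)) (hdj _ _ (by omega)))
      rcases h01 with rfl | rfl
      · exact Ideal.mul_mem_right _ _ (hd 2)
      · exact Ideal.mul_mem_left _ _ (hd 3)
  have hne : ∀ i, d i ≠ 0 := by
    intro i h0
    obtain ⟨j, hj⟩ := exists_ne i
    exact hdj i j hj (h0 ▸ zero_mem _)
  have hm0 : (d 0 * d 1 + d 2 * d 3) * d 4 ≠ 0 := fun h0 => hm 0 (by decide) (h0 ▸ zero_mem _)
  have hmu : ¬ IsUnit ((d 0 * d 1 + d 2 * d 3) * d 4) := fun hu =>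
    (hp 4).ne_top (Ideal.eq_top_of_isUnit_mem _ (Ideal.mul_mem_left _ _ (hd 4)) hu)
  exact not_isValuativeDomain_adjoin_inv (K := K) (p₁ := M 0) (p₂ := M 1) (q₁ := M 2) (q₂ := M 3)
    (mul_ne_zero (hne 0) (hne 1)) (mul_ne_zero (hne 2) (hne 3)) (dvd_mul_right _ _)
    (dvd_mul_right _ _) (hd 0) (hdj 0 1 (by decide)) (Ideal.mul_mem_left _ _ (hd 1))
    (dvd_mul_right _ _) (hd 2) (hdj 2 3 (by decide)) (Ideal.mul_mem_left _ _ (hd 3))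
    (hm 0 (by decide)) (hm 1 (by decide)) (hm 2 (by decide)) (hm 3 (by decide))
    (h _ (bot_lt_adjoin_inv hm0 hmu))

theorem finite_setOf_isMaximal_of_overrings_valuative {R K : Type*} [CommRing R] [IsDomain R]
    [Field K] [Algebra R K] [IsFractionRing R K]
    (h : ∀ S : Subalgebra R K, ⊥ < S → IsValuativeDomain S) :
    {M : Ideal R | M.IsMaximal}.Finite := by
  by_contra hinf
  have hinf : Set.Infinite {M : Ideal R | M.IsMaximal} := hinf
  let f := hinf.natEmbedding
  refine not_injective_of_overrings_valuative h (fun i => (f i : Ideal R)) (fun i => (f i).2) ?_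
  intro i j hij
  exact Fin.ext (f.injective (Subtype.ext hij))

/-! ### Spectral description for Bézout domains -/

/-- Two pairs of distinct primes such that no prime of one pair is comparable with a prime of the
other pair. -/
structure IsCrossPair {R : Type*} [CommRing R] (p₁ p₂ q₁ q₂ : Ideal R) : Prop where
  prime_left₁ : p₁.IsPrime
  prime_left₂ : p₂.IsPrime
  prime_right₁ : q₁.IsPrime
  prime_right₂ : q₂.IsPrime
  ne_left : p₁ ≠ p₂
  ne_right : q₁ ≠ q₂
  incomp₁₁ : ¬ p₁ ≤ q₁ ∧ ¬ q₁ ≤ p₁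
  incomp₁₂ : ¬ p₁ ≤ q₂ ∧ ¬ q₂ ≤ p₁
  incomp₂₁ : ¬ p₂ ≤ q₁ ∧ ¬ q₁ ≤ p₂
  incomp₂₂ : ¬ p₂ ≤ q₂ ∧ ¬ q₂ ≤ p₂

/-- The primes of `R` contain a cross pair, and every cross pair contains all maximal ideals. -/
def CrossPairsCoverMaximals (R : Type*) [CommRing R] : Prop :=
  (∃ p₁ p₂ q₁ q₂ : Ideal R, IsCrossPair p₁ p₂ q₁ q₂) ∧
    ∀ p₁ p₂ q₁ q₂ : Ideal R, IsCrossPair p₁ p₂ q₁ q₂ → ∀ M : Ideal R, M.IsMaximal →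
      M = p₁ ∨ M = p₂ ∨ M = q₁ ∨ M = q₂

theorem IsBezout.exists_gcd {R : Type*} [CommRing R] [IsBezout R] (a b : R) :
    ∃ g : R, g ∣ a ∧ g ∣ b ∧ ∃ u v, u * a + v * b = g := by
  obtain ⟨u, v, h⟩ := IsBezout.gcd_eq_sum a b
  exact ⟨IsBezout.gcd a b, IsBezout.gcd_dvd_left _ _, IsBezout.gcd_dvd_right _ _, u, v, h⟩

/-- An element of two distinct primes has a divisor that lies in exactly one of them. -/
theorem IsBezout.exists_dvd_mem_notMem {R : Type*} [CommRing R] [IsBezout R]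
    {p₁ p₂ : Ideal R} (hne : p₁ ≠ p₂) {a : R} (h₁ : a ∈ p₁) (h₂ : a ∈ p₂) :
    ∃ c, c ∣ a ∧ (c ∈ p₁ ∧ c ∉ p₂ ∨ c ∈ p₂ ∧ c ∉ p₁) := by
  have key : ∀ {p q : Ideal R}, a ∈ p → ¬ p ≤ q → ∃ c, c ∣ a ∧ c ∈ p ∧ c ∉ q := by
    intro p q ha hpq
    obtain ⟨d, hd, hd'⟩ := SetLike.not_le_iff_exists.mp hpq
    obtain ⟨c, hca, hcd, u, v, h⟩ := IsBezout.exists_gcd a d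
    exact ⟨c, hca, h ▸ add_mem (p.mul_mem_left _ ha) (p.mul_mem_left _ hd),
      fun hc => hd' (q.mem_of_dvd hcd hc)⟩
  by_cases hle : p₁ ≤ p₂
  · obtain ⟨c, h, h'⟩ := key h₂ fun h => hne (le_antisymm hle h)
    exact ⟨c, h, Or.inr h'⟩
  · obtain ⟨c, h, h'⟩ := key h₁ hle
    exact ⟨c, h, Or.inl h'⟩

/-- Prime avoidance. Inverting such an $m$ enlarges $R$ but keeps the four primes. -/
theorem IsCrossPair.exists_notMem {R : Type*} [CommRing R] {p₁ p₂ q₁ q₂ : Ideal R}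
    (h : IsCrossPair p₁ p₂ q₁ q₂) {M : Ideal R} (hM : M.IsMaximal)
    (hne : ¬ (M = p₁ ∨ M = p₂ ∨ M = q₁ ∨ M = q₂)) :
    ∃ m ∈ M, m ∉ p₁ ∧ m ∉ p₂ ∧ m ∉ q₁ ∧ m ∉ q₂ := by
  by_contra! hcon
  let f : Fin 4 → Ideal R := ![p₁, p₂, q₁, q₂]
  have hf : ∀ i, (f i).IsPrime := by
    intro i
    fin_cases i
    exacts [h.prime_left₁, h.prime_left₂, h.prime_right₁, h.prime_right₂]
  have hsub : (M : Set R) ⊆ ⋃ i ∈ ((Finset.univ : Finset (Fin 4)) : Set _), (f i : Set R) := by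
    intro m hm
    have : m ∈ p₁ ∨ m ∈ p₂ ∨ m ∈ q₁ ∨ m ∈ q₂ := by
      by_contra! h'
      exact h'.2.2.2 (hcon m hm h'.1 h'.2.1 h'.2.2.1)
    simp only [Finset.coe_univ, Set.mem_univ, Set.iUnion_true, Set.mem_iUnion, SetLike.mem_coe]
    rcases this with h | h | h | h
    exacts [⟨0, h⟩, ⟨1, h⟩, ⟨2, h⟩, ⟨3, h⟩]
  obtain ⟨i, -, hle⟩ := (Ideal.subset_union_prime 0 0 fun i _ _ _ => hf i).mp hsub
  have heq := hM.eq_of_le (hf i).ne_top hle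
  refine hne ?_
  fin_cases i
  exacts [Or.inl heq, Or.inr (Or.inl heq), Or.inr (Or.inr (Or.inl heq)),
    Or.inr (Or.inr (Or.inr heq))]

/-! ### Cross pairs and valuativity over a Bézout domain -/

section Bezout

variable {R : Type*} [CommRing R] [IsDomain R] [IsBezout R]

theorem IsBezout.exists_isCoprime_div (a : R) {b : R} (hb : b ≠ 0) :
    ∃ g a' b' : R, a = g * a' ∧ b = g * b' ∧ g ≠ 0 ∧ IsCoprime a' b' := by
  obtain ⟨g, ⟨a', rfl⟩, ⟨b', rfl⟩, u, v, h⟩ := IsBezout.exists_gcd a b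
  have hg : g ≠ 0 := left_ne_zero_of_mul hb
  exact ⟨g, a', b', rfl, rfl, hg, u, v, mul_left_cancel₀ hg (by linear_combination h)⟩

/-- Divide $u\in p\setminus q$ and $v\in q\setminus p$ by their gcd. It lies in neither prime, so
the coprime quotients remain in $p$ and $q$. -/
theorem IsBezout.isCoprime_of_incomparable {p q : Ideal R} (hp : p.IsPrime) (hq : q.IsPrime)
    (hpq : ¬ p ≤ q) (hqp : ¬ q ≤ p) : IsCoprime p q := by
  obtain ⟨u, hu, hu'⟩ := SetLike.not_le_iff_exists.mp hpq
  obtain ⟨v, hv, hv'⟩ := SetLike.not_le_iff_exists.mp hqp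
  have hv0 : v ≠ 0 := fun h => hv' (h ▸ zero_mem _)
  obtain ⟨g, u', v', rfl, rfl, -, r, s, h⟩ := IsBezout.exists_isCoprime_div u hv0
  have h1 : u' ∈ p := (hp.mem_or_mem hu).resolve_left fun h => hv' (p.mul_mem_right _ h)
  have h2 : v' ∈ q := (hq.mem_or_mem hv).resolve_left fun h => hu' (q.mul_mem_right _ h)
  exact Ideal.isCoprime_iff_exists.mpr ⟨_, p.mul_mem_left r h1, _, q.mul_mem_left s h2, h⟩

theorem IsBezout.le_or_le_of_le {p q M : Ideal R} (hp : p.IsPrime) (hq : q.IsPrime)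
    (hM : M.IsPrime) (hpM : p ≤ M) (hqM : q ≤ M) : p ≤ q ∨ q ≤ p := by
  by_contra! h
  have := Ideal.isCoprime_iff_sup_eq.mp (IsBezout.isCoprime_of_incomparable hp hq h.1 h.2)
  exact hM.ne_top (top_le_iff.mp (this ▸ sup_le hpM hqM))

theorem IsCrossPair.exists_separating {p₁ p₂ q₁ q₂ : Ideal R} (h : IsCrossPair p₁ p₂ q₁ q₂) :
    ∃ a b c d : R, a + b = 1 ∧ a ≠ 0 ∧ b ≠ 0 ∧ (a ∈ p₁ ∧ a ∈ p₂) ∧ (b ∈ q₁ ∧ b ∈ q₂) ∧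
      (c ∣ a ∧ (c ∈ p₁ ∧ c ∉ p₂ ∨ c ∈ p₂ ∧ c ∉ p₁)) ∧
      (d ∣ b ∧ (d ∈ q₁ ∧ d ∉ q₂ ∨ d ∈ q₂ ∧ d ∉ q₁)) := by
  have h1 := h.prime_left₁
  have h2 := h.prime_left₂
  have h3 := h.prime_right₁
  have h4 := h.prime_right₂
  have hcop : IsCoprime (p₁ * p₂) (q₁ * q₂) :=
    ((IsBezout.isCoprime_of_incomparable h1 h3 h.incomp₁₁.1 h.incomp₁₁.2).mul_right
      (IsBezout.isCoprime_of_incomparable h1 h4 h.incomp₁₂.1 h.incomp₁₂.2)).mul_left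
    ((IsBezout.isCoprime_of_incomparable h2 h3 h.incomp₂₁.1 h.incomp₂₁.2).mul_right
      (IsBezout.isCoprime_of_incomparable h2 h4 h.incomp₂₂.1 h.incomp₂₂.2))
  obtain ⟨a, ha, b, hb, hab⟩ := Ideal.isCoprime_iff_exists.mp hcop
  obtain ⟨ha1, ha2⟩ := Ideal.mul_le_inf ha
  obtain ⟨hb1, hb2⟩ := Ideal.mul_le_inf hb
  have ha0 : a ≠ 0 := by
    rintro rfl
    exact h3.one_notMem (by rwa [← hab, zero_add])
  have hb0 : b ≠ 0 := by
    rintro rfl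
    exact h1.one_notMem (by rwa [← hab, add_zero])
  obtain ⟨c, hc⟩ := IsBezout.exists_dvd_mem_notMem h.ne_left ha1 ha2
  obtain ⟨d, hd⟩ := IsBezout.exists_dvd_mem_notMem h.ne_right hb1 hb2
  exact ⟨a, b, c, d, hab, ha0, hb0, ⟨ha1, ha2⟩, ⟨hb1, hb2⟩, hc, hd⟩

theorem IsCrossPair.not_isValuativeDomain {p₁ p₂ q₁ q₂ : Ideal R}
    (h : IsCrossPair p₁ p₂ q₁ q₂) : ¬ IsValuativeDomain R := by
  obtain ⟨a, b, c, d, hab, ha0, hb0, ⟨ha1, ha2⟩, ⟨hb1, hb2⟩, ⟨hca, hc⟩, ⟨hdb, hd⟩⟩ :=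
    h.exists_separating
  have key : ∀ {p q : Ideal R} {x y : R}, p.IsPrime → q.IsPrime → x ∈ p → x ∈ q →
      (y ∈ p ∧ y ∉ q ∨ y ∈ q ∧ y ∉ p) → ¬ IsUnit y ∧ ∀ n, ¬ x ∣ y ^ n := by
    rintro p q x y hp hq hxp hxq (⟨h, h'⟩ | ⟨h, h'⟩)
    · exact ⟨fun hu => hp.ne_top (Ideal.eq_top_of_isUnit_mem _ h hu),
        fun n hn => h' (hq.mem_of_pow_mem n (q.mem_of_dvd hn hxq))⟩
    · exact ⟨fun hu => hq.ne_top (Ideal.eq_top_of_isUnit_mem _ h hu),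
        fun n hn => h' (hp.mem_of_pow_mem n (p.mem_of_dvd hn hxp))⟩
  have kc := key h.prime_left₁ h.prime_left₂ ha1 ha2 hc
  have kd := key h.prime_right₁ h.prime_right₂ hb1 hb2 hd
  exact not_isValuativeDomain_of_isUnit_add (hab ▸ isUnit_one) ha0 hb0 hca kc.1 kc.2 hdb kd.1 kd.2

theorem IsCrossPair.not_isValuativeDomain_adjoin_inv {K : Type*} [Field K] [Algebra R K]
    [IsFractionRing R K] {p₁ p₂ q₁ q₂ : Ideal R} (h : IsCrossPair p₁ p₂ q₁ q₂) {m : R}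
    (hp₁ : m ∉ p₁) (hp₂ : m ∉ p₂) (hq₁ : m ∉ q₁) (hq₂ : m ∉ q₂) :
    ¬ IsValuativeDomain (Algebra.adjoin R {(algebraMap R K m)⁻¹}) := by
  have h1 := h.prime_left₁
  have h2 := h.prime_left₂
  have h3 := h.prime_right₁
  have h4 := h.prime_right₂
  obtain ⟨a, b, c, d, hab, ha0, hb0, ⟨ha1, ha2⟩, ⟨hb1, hb2⟩, ⟨hca, hc⟩, ⟨hdb, hd⟩⟩ :=
    h.exists_separating
  have hm : a + b ∣ m := hab ▸ one_dvd m
  rcases hc with ⟨hc, hc'⟩ | ⟨hc, hc'⟩ <;> rcases hd with ⟨hd, hd'⟩ | ⟨hd, hd'⟩ <;>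
    exact _root_.not_isValuativeDomain_adjoin_inv ha0 hb0 hm hca hc hc' ‹_› hdb hd hd' ‹_›
      ‹_› ‹_› ‹_› ‹_›

/-- If at most one prime contains `b`, then no ring lies strictly between `R` and `R[a/b]`. -/
theorem IsBezout.hasNoIntermediateRing_of_subsingleton {K : Type*} [Field K] [Algebra R K]
    [IsFractionRing R K] (a : R) {b : R} (hb : b ≠ 0)
    (h : ∀ p q : Ideal R, p.IsPrime → q.IsPrime → b ∈ p → b ∈ q → p = q) :
    HasNoIntermediateRing (Algebra.adjoin R {algebraMap R K a / algebraMap R K b}) := by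
  intro S hS
  have inj := IsFractionRing.injective R K
  have hb' : algebraMap R K b ≠ 0 := by simpa using hb
  by_cases hbot : S = ⊥
  · exact Or.inl hbot
  refine Or.inr (le_antisymm hS ?_)
  obtain ⟨y, hyS, hy⟩ := SetLike.not_le_iff_exists.mp (fun h => hbot (le_bot_iff.mp h) : ¬ S ≤ ⊥)
  obtain ⟨u₀, v₀, hv₀, rfl⟩ := IsFractionRing.div_surjective (A := R) y
  have hv₀' := nonZeroDivisors.ne_zero hv₀
  obtain ⟨g, u, v, rfl, rfl, hg, r, s, huv⟩ := IsBezout.exists_isCoprime_div u₀ hv₀'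
  have hv : algebraMap R K v ≠ 0 := by simpa using right_ne_zero_of_mul hv₀'
  have hg' : algebraMap R K g ≠ 0 := by simpa using hg
  rw [map_mul, map_mul, mul_div_mul_left _ _ hg'] at hyS hy
  -- From $ru+sv=1$ and $y=u/v$ one gets $1/v=ry+s$.
  have hvinv : (algebraMap R K v)⁻¹ ∈ S := by
    have := add_mem (mul_mem (algebraMap_mem S r) hyS) (algebraMap_mem S s)
    convert this using 1
    have := congrArg (algebraMap R K) huv
    simp only [map_add, map_mul, map_one] at this
    field_simp
    linear_combination -this
  have hvu : ¬ IsUnit v := by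
    intro hv
    refine hy ?_
    obtain ⟨w, hw⟩ := hv.exists_right_inv
    refine Algebra.mem_bot.mpr ⟨u * w, ?_⟩
    rw [eq_div_iff ‹_›, ← map_mul, mul_assoc, mul_comm w, hw, mul_one]
  have hle : Algebra.adjoin R {algebraMap R K a / algebraMap R K b} ≤
      Algebra.adjoin R {(algebraMap R K b)⁻¹} := by
    refine Algebra.adjoin_le (Set.singleton_subset_iff.mpr ?_)
    rw [div_eq_mul_inv]
    exact mul_mem (algebraMap_mem _ a) (Algebra.self_mem_adjoin_singleton R _)
  obtain ⟨k, w, hw⟩ := exists_pow_mul_eq_of_mem_adjoin_inv hb' (hle (hS hyS))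
  have hvb : v ∣ b ^ k := by
    refine IsCoprime.dvd_of_dvd_mul_left (x := v) (y := u) ⟨s, r, by rw [add_comm]; exact huv⟩ ?_
    refine ⟨w, inj ?_⟩
    rw [map_mul, map_mul, ← hw, map_pow]
    field_simp
  -- A maximal ideal containing the nonunit $v$ contains $b$, since $v\mid b^k$. It is then the only
  -- prime over $b$, so $v$ is in the radical of $(b)$; from $v^n=bt$ follows $a/b=at\,v^{-n}\in S$.
  have hvrad : v ∈ (Ideal.span {b}).radical := by
    rw [Ideal.radical_eq_sInf, Ideal.mem_sInf]
    rintro p ⟨hbp, hp⟩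
    rw [Ideal.span_singleton_le_iff_mem] at hbp
    obtain ⟨M, hM, hvM⟩ := exists_max_ideal_of_mem_nonunits hvu
    have hbM : b ∈ M := hM.isPrime.mem_of_pow_mem k (M.mem_of_dvd hvb hvM)
    rwa [h p M hp hM.isPrime hbp hbM]
  obtain ⟨n, hn⟩ := hvrad
  obtain ⟨t, ht⟩ := Ideal.mem_span_singleton.mp hn
  refine Algebra.adjoin_le (Set.singleton_subset_iff.mpr ?_)
  have hmem := mul_mem (algebraMap_mem S (a * t)) (pow_mem hvinv n)
  rw [SetLike.mem_coe]
  convert hmem using 1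
  rw [inv_pow, ← map_pow, ht, map_mul, map_mul]
  have ht0 : algebraMap R K t ≠ 0 := by
    have : b * t ≠ 0 := ht ▸ pow_ne_zero n (right_ne_zero_of_mul hv₀')
    simpa using right_ne_zero_of_mul this
  field_simp

/-- A Bézout domain without cross pairs of primes is valuative. -/
theorem IsBezout.isValuativeDomain_of_not_isCrossPair
    (h : ∀ p₁ p₂ q₁ q₂ : Ideal R, ¬ IsCrossPair p₁ p₂ q₁ q₂) : IsValuativeDomain R := by
  intro x
  by_cases hx : x = 0
  · left
    intro S hS
    left
    rw [hx, Algebra.adjoin_singleton_zero] at hS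
    exact le_bot_iff.mp hS
  obtain ⟨a₀, b₀, hb₀, rfl⟩ := IsFractionRing.div_surjective (A := R) x
  have hb₀' := nonZeroDivisors.ne_zero hb₀
  obtain ⟨g, a, b, rfl, rfl, hg, hab⟩ := IsBezout.exists_isCoprime_div a₀ hb₀'
  have hb := right_ne_zero_of_mul hb₀'
  have ha : a ≠ 0 := by
    rintro rfl
    simp at hx
  rw [map_mul, map_mul, mul_div_mul_left _ _ (by simpa using hg), inv_div]
  by_contra hcon
  rw [not_or] at hcon
  have h1 := mt (IsBezout.hasNoIntermediateRing_of_subsingleton a hb) hcon.1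
  have h2 := mt (IsBezout.hasNoIntermediateRing_of_subsingleton b ha) hcon.2
  push Not at h1 h2
  obtain ⟨q₁, q₂, hq₁, hq₂, hb₁, hb₂, hq⟩ := h1
  obtain ⟨p₁, p₂, hp₁, hp₂, ha₁, ha₂, hp⟩ := h2
  have key : ∀ p q : Ideal R, p.IsPrime → q.IsPrime → a ∈ p → b ∈ q → ¬ p ≤ q ∧ ¬ q ≤ p := by
    obtain ⟨u, v, huv⟩ := hab
    intro p q hp hq ha hb
    constructor
    · intro hle
      exact hq.one_notMem (huv ▸ add_mem (q.mul_mem_left u (hle ha)) (q.mul_mem_left v hb))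
    · intro hle
      exact hp.one_notMem (huv ▸ add_mem (p.mul_mem_left u ha) (p.mul_mem_left v (hle hb)))
  exact h p₁ p₂ q₁ q₂ ⟨hp₁, hp₂, hq₁, hq₂, hp, hq, key _ _ hp₁ hq₁ ha₁ hb₁,
    key _ _ hp₁ hq₂ ha₁ hb₂, key _ _ hp₂ hq₁ ha₂ hb₁, key _ _ hp₂ hq₂ ha₂ hb₂⟩

/-! ### Overrings of Bézout domains -/

variable {K : Type*} [Field K] [Algebra R K] [IsFractionRing R K]

/-- Every element of an overring of a Bézout domain is a unit multiple of an element of the base;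
the denominator in lowest terms is invertible in the overring. -/
theorem IsBezout.exists_eq_mul_of_overring (S : Subalgebra R K) (y : S) :
    ∃ (u v : R) (w : S), y * algebraMap R S v = algebraMap R S u ∧ algebraMap R S v * w = 1 := by
  obtain ⟨u₀, v₀, hv₀, hy⟩ := IsFractionRing.div_surjective (A := R) (y : K)
  have hv₀' := nonZeroDivisors.ne_zero hv₀
  obtain ⟨g, u, v, rfl, rfl, hg, r, s, huv⟩ := IsBezout.exists_isCoprime_div u₀ hv₀'
  have hv : algebraMap R K v ≠ 0 := by simpa using right_ne_zero_of_mul hv₀'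
  rw [map_mul, map_mul, mul_div_mul_left _ _ (by simpa using hg)] at hy
  have h1 : y * algebraMap R S v = algebraMap R S u := by
    apply Subtype.ext
    change (y : K) * algebraMap R K v = algebraMap R K u
    rw [← hy]; field_simp
  refine ⟨u, v, algebraMap R S r * y + algebraMap R S s, h1, ?_⟩
  rw [mul_add, mul_left_comm, mul_comm _ y, h1, ← map_mul, ← map_mul, ← map_add, mul_comm v, huv,
    map_one]

/-- Each element of $S$ is a unit of $S$ times an element of $R$, so a gcd taken in $R$ also serves
in $S$. -/
theorem IsBezout.overring (S : Subalgebra R K) : IsBezout S := by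
  rw [IsBezout.iff_span_pair_isPrincipal]
  intro y z
  obtain ⟨u, v, w, hu, hw⟩ := IsBezout.exists_eq_mul_of_overring S y
  obtain ⟨u', v', w', hu', hw'⟩ := IsBezout.exists_eq_mul_of_overring S z
  obtain ⟨g, ⟨c, hc⟩, ⟨c', hc'⟩, r, s, hg⟩ := IsBezout.exists_gcd u u'
  refine ⟨algebraMap R S g, le_antisymm (Ideal.span_le.mpr ?_)
    ((Ideal.span_singleton_le_iff_mem _).mpr ?_)⟩
  · rintro t (rfl | ht)
    · refine Ideal.mem_span_singleton.mpr ⟨algebraMap R S c * w, ?_⟩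
      rw [← mul_assoc, ← map_mul, ← hc, ← hu, mul_assoc, hw, mul_one]
    · rw [Set.mem_singleton_iff] at ht
      subst ht
      refine Ideal.mem_span_singleton.mpr ⟨algebraMap R S c' * w', ?_⟩
      rw [← mul_assoc, ← map_mul, ← hc', ← hu', mul_assoc, hw', mul_one]
  · rw [← hg, map_add, map_mul, map_mul, ← hu, ← hu']
    refine add_mem ?_ ?_ <;> refine Ideal.mul_mem_left _ _ (Ideal.mul_mem_right _ _ ?_) <;>
      exact Ideal.subset_span (by simp)

theorem IsBezout.comap_overring_le_iff (S : Subalgebra R K) {I J : Ideal S} :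
    I.comap (algebraMap R S) ≤ J.comap (algebraMap R S) ↔ I ≤ J := by
  refine ⟨fun h y hy => ?_, fun h => Ideal.comap_mono h⟩
  obtain ⟨u, v, w, hu, hw⟩ := IsBezout.exists_eq_mul_of_overring S y
  have h1 : u ∈ I.comap (algebraMap R S) := by
    rw [Ideal.mem_comap, ← hu]
    exact I.mul_mem_right _ hy
  have h2 := h h1
  rw [Ideal.mem_comap, ← hu] at h2
  have := J.mul_mem_right w h2
  rwa [mul_assoc, hw, mul_one] at this

theorem IsCrossPair.comap_overring {S : Subalgebra R K} {p₁ p₂ q₁ q₂ : Ideal S}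
    (h : IsCrossPair p₁ p₂ q₁ q₂) :
    IsCrossPair (p₁.comap (algebraMap R S)) (p₂.comap (algebraMap R S))
      (q₁.comap (algebraMap R S)) (q₂.comap (algebraMap R S)) := by
  have h1 := h.prime_left₁
  have h2 := h.prime_left₂
  have h3 := h.prime_right₁
  have h4 := h.prime_right₂
  have ne : ∀ {I J : Ideal S}, I ≠ J → I.comap (algebraMap R S) ≠ J.comap (algebraMap R S) := by
    intro I J hIJ h
    exact hIJ (le_antisymm ((IsBezout.comap_overring_le_iff S).mp h.le)
      ((IsBezout.comap_overring_le_iff S).mp h.ge))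
  constructor
  · exact inferInstance
  · exact inferInstance
  · exact inferInstance
  · exact inferInstance
  · exact ne h.ne_left
  · exact ne h.ne_right
  all_goals simp only [IsBezout.comap_overring_le_iff]
  · exact h.incomp₁₁
  · exact h.incomp₁₂
  · exact h.incomp₂₁
  · exact h.incomp₂₂

variable (R)

theorem IsBezout.isMaximalNonValuativeDomain_iff :
    IsMaximalNonValuativeDomain R ↔ CrossPairsCoverMaximals R := by
  let K := FractionRing R
  constructor
  · rintro ⟨-, hnot, hover⟩
    refine ⟨?_, fun p₁ p₂ q₁ q₂ h M hM => ?_⟩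
    · by_contra! hcon
      exact hnot (IsBezout.isValuativeDomain_of_not_isCrossPair hcon)
    · by_contra hne
      obtain ⟨m, hmM, h1, h2, h3, h4⟩ := h.exists_notMem hM hne
      refine h.not_isValuativeDomain_adjoin_inv (K := K) h1 h2 h3 h4
        (hover _ (bot_lt_adjoin_inv (fun h0 => h1 (h0 ▸ zero_mem _)) fun hu => ?_))
      exact hM.ne_top (Ideal.eq_top_of_isUnit_mem _ hmM hu)
  · rintro ⟨⟨p₁, p₂, q₁, q₂, h⟩, hall⟩
    refine ⟨fun hbot => ?_, fun hval => ?_, fun S hS => ?_⟩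
    -- If $R=K$, the only prime is zero, and a cross pair needs distinct primes.
    · have hinj := FaithfulSMul.algebraMap_injective R K
      have hfield : IsField R := by
        refine MulEquiv.isField (Field.toIsField K)
          (RingEquiv.ofBijective (algebraMap R K) ⟨hinj, fun y => ?_⟩).toMulEquiv
        exact Algebra.mem_bot.mp (hbot ▸ Algebra.mem_top : y ∈ (⊥ : Subalgebra R K))
      have hle : ∀ p : Ideal R, p.IsPrime → p = ⊥ := by
        intro p hp
        let := hfield.toField
        exact (Ideal.eq_bot_or_top p).resolve_right hp.ne_top
      exact h.ne_left ((hle _ h.prime_left₁).trans (hle _ h.prime_left₂).symm)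
    · exact h.not_isValuativeDomain hval
    · have := IsBezout.overring S
      refine IsBezout.isValuativeDomain_of_not_isCrossPair fun P₁ P₂ Q₁ Q₂ hS' => ?_
      obtain ⟨y, hyS, hy⟩ := SetLike.not_le_iff_exists.mp hS.not_ge
      obtain ⟨u, v, w, hu, hw⟩ := IsBezout.exists_eq_mul_of_overring S ⟨y, hyS⟩
      have hvS : IsUnit (algebraMap R S v) := IsUnit.of_mul_eq_one w hw
      have hv : ¬ IsUnit v := by
        intro hv
        obtain ⟨t, ht⟩ := hv.exists_right_inv
        refine hy (Algebra.mem_bot.mpr ⟨u * t, ?_⟩)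
        have hu' : y * algebraMap R K v = algebraMap R K u := congrArg Subtype.val hu
        rw [map_mul, ← hu', mul_assoc, ← map_mul, ht, map_one, mul_one]
      -- The nonunit $v$ of $R$ is invertible in $S$, so a maximal ideal over $v$ is not contracted
      -- from any prime of $S$. A cross pair of $S$ would contract to one missing it.
      obtain ⟨M, hM, hvM⟩ := exists_max_ideal_of_mem_nonunits hv
      have not_mem : ∀ P : Ideal S, P.IsPrime → M ≠ P.comap (algebraMap R S) := by
        rintro P hP rfl
        exact hP.ne_top (Ideal.eq_top_of_isUnit_mem _ hvM hvS)
      rcases hall _ _ _ _ hS'.comap_overring M hM with h | h | h | h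
      exacts [not_mem _ hS'.prime_left₁ h, not_mem _ hS'.prime_left₂ h,
        not_mem _ hS'.prime_right₁ h, not_mem _ hS'.prime_right₂ h]

end Bezout

/-! ### Combinatorics of cross pairs -/

section Symmetry

variable {R : Type*} [CommRing R] {p₁ p₂ q₁ q₂ : Ideal R}

theorem IsCrossPair.swap (h : IsCrossPair p₁ p₂ q₁ q₂) : IsCrossPair q₁ q₂ p₁ p₂ :=
  ⟨h.prime_right₁, h.prime_right₂, h.prime_left₁, h.prime_left₂, h.ne_right, h.ne_left,
    h.incomp₁₁.symm, h.incomp₂₁.symm, h.incomp₁₂.symm, h.incomp₂₂.symm⟩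

theorem IsCrossPair.swap_left (h : IsCrossPair p₁ p₂ q₁ q₂) : IsCrossPair p₂ p₁ q₁ q₂ :=
  ⟨h.prime_left₂, h.prime_left₁, h.prime_right₁, h.prime_right₂, h.ne_left.symm, h.ne_right,
    h.incomp₂₁, h.incomp₂₂, h.incomp₁₁, h.incomp₁₂⟩

theorem IsCrossPair.swap_right (h : IsCrossPair p₁ p₂ q₁ q₂) : IsCrossPair p₁ p₂ q₂ q₁ :=
  h.swap.swap_left.swap

theorem IsCrossPair.ncard_eq_four (h : IsCrossPair p₁ p₂ q₁ q₂) :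
    ({p₁, p₂, q₁, q₂} : Set (Ideal R)).ncard = 4 := by
  have h1 := h.ne_left
  have h2 := h.ne_right
  have h3 : p₁ ≠ q₁ := fun e => h.incomp₁₁.1 e.le
  have h4 : p₁ ≠ q₂ := fun e => h.incomp₁₂.1 e.le
  have h5 : p₂ ≠ q₁ := fun e => h.incomp₂₁.1 e.le
  have h6 : p₂ ≠ q₂ := fun e => h.incomp₂₂.1 e.le
  rw [Set.ncard_insert_of_notMem (by simp [h1, h3, h4]) (Set.toFinite _),
    Set.ncard_insert_of_notMem (by simp [h5, h6]) (Set.toFinite _), Set.ncard_pair h2]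

/-- A cross pair either consists of maximal ideals or can be rearranged so that its first prime is
not maximal. -/
theorem IsCrossPair.maximal_or_exists (h : IsCrossPair p₁ p₂ q₁ q₂) :
    (p₁.IsMaximal ∧ p₂.IsMaximal ∧ q₁.IsMaximal ∧ q₂.IsMaximal) ∨
      ∃ a₁ a₂ b₁ b₂ : Ideal R, IsCrossPair a₁ a₂ b₁ b₂ ∧ ¬ a₁.IsMaximal ∧
        ({a₁, a₂, b₁, b₂} : Set (Ideal R)) = {p₁, p₂, q₁, q₂} := by
  by_cases h1 : p₁.IsMaximal
  swap
  · exact Or.inr ⟨_, _, _, _, h, h1, rfl⟩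
  by_cases h2 : p₂.IsMaximal
  swap
  · exact Or.inr ⟨_, _, _, _, h.swap_left, h2, by ext; simp; tauto⟩
  by_cases h3 : q₁.IsMaximal
  swap
  · exact Or.inr ⟨_, _, _, _, h.swap, h3, by ext; simp; tauto⟩
  by_cases h4 : q₂.IsMaximal
  swap
  · exact Or.inr ⟨_, _, _, _, h.swap.swap_left, h4, by ext; simp; tauto⟩
  exact Or.inl ⟨h1, h2, h3, h4⟩

end Symmetry

/-! ### From covering cross pairs to the three configurations -/

section Combinatorics

variable {R : Type*} [CommRing R]

theorem IsNonMaximalPrime.exists_le_maximal {P : Ideal R} (hP : IsNonMaximalPrime P) :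
    ∃ M : Ideal R, M.IsMaximal ∧ P ≤ M ∧ P ≠ M := by
  obtain ⟨M, hM, hle⟩ := P.exists_le_maximal hP.1.ne_top
  exact ⟨M, hM, hle, fun e => hP.2 (e ▸ hM)⟩

theorem IsNonMaximalPrime.not_maximal_le {P M : Ideal R} (hP : IsNonMaximalPrime P)
    (hM : M.IsMaximal) : ¬ M ≤ P :=
  fun h => hP.2 (hM.eq_of_le hP.1.ne_top h ▸ hM)

theorem Ideal.IsMaximal.incomparable {M N : Ideal R} (hM : M.IsMaximal) (hN : N.IsMaximal)
    (h : M ≠ N) : ¬ M ≤ N ∧ ¬ N ≤ M :=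
  ⟨fun h' => h (hM.eq_of_le hN.ne_top h'), fun h' => h (hN.eq_of_le hM.ne_top h').symm⟩

theorem incomparable_of_le_of_not_le {P Q M N : Ideal R} (hPM : P ≤ M) (hPN : ¬ P ≤ N)
    (hQN : Q ≤ N) (hQM : ¬ Q ≤ M) : ¬ P ≤ Q ∧ ¬ Q ≤ P :=
  ⟨fun h => hPN (h.trans hQN), fun h => hQM (h.trans hPM)⟩

/-- By counting, some member $P$ is not maximal, and the other three are the maximal ideals. A
second candidate $P'$ would give the cross pair $P,P';M,N$, missing $U$. A non-maximal $Q\not\le U$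
below $X\in\{M,N\}$ would give $P,U;Q,X$, missing the remaining maximal ideal. -/
theorem CrossPairsCoverMaximals.bezoutThreeMaximal [IsBezout R]
    (h : CrossPairsCoverMaximals R)
    (hcard : {M : Ideal R | M.IsMaximal}.ncard = 3) : BezoutThreeMaximal R := by
  obtain ⟨⟨p₁, p₂, q₁, q₂, hc⟩, hcov⟩ := h
  have hfin : {M : Ideal R | M.IsMaximal}.Finite := Set.finite_of_ncard_ne_zero (by omega)
  obtain ⟨P, U, M, N, hc, hP⟩ : ∃ P U M N : Ideal R, IsCrossPair P U M N ∧ ¬ P.IsMaximal := by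
    rcases hc.maximal_or_exists with ⟨h1, h2, h3, h4⟩ | ⟨a₁, a₂, b₁, b₂, h, h', -⟩
    · have := Set.ncard_le_ncard (s := {p₁, p₂, q₁, q₂}) (by
        rintro X (rfl | rfl | rfl | rfl) <;> assumption) hfin
      rw [hc.ncard_eq_four] at this
      omega
    · exact ⟨a₁, a₂, b₁, b₂, h, h'⟩
  have hUM : U ≠ M := fun e => hc.incomp₂₁.1 e.le
  have hUN : U ≠ N := fun e => hc.incomp₂₂.1 e.le
  have hset : {M : Ideal R | M.IsMaximal} = {U, M, N} := by
    refine Set.eq_of_subset_of_ncard_le ?_ ?_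
    · intro X hX
      rcases hcov _ _ _ _ hc X hX with rfl | rfl | rfl | rfl
      exacts [absurd hX hP, by simp, by simp, by simp]
    · rw [hcard, Set.ncard_insert_of_notMem (by simp [hUM, hUN]) (Set.toFinite _),
        Set.ncard_pair hc.ne_right]
  have hU : U.IsMaximal := (hset ▸ (by simp : U ∈ ({U, M, N} : Set (Ideal R))) :)
  have hM : M.IsMaximal := (hset ▸ (by simp : M ∈ ({U, M, N} : Set (Ideal R))) :)
  have hN : N.IsMaximal := (hset ▸ (by simp : N ∈ ({U, M, N} : Set (Ideal R))) :)
  have le_or : ∀ p : Ideal R, p.IsPrime → p ≤ U ∨ p ≤ M ∨ p ≤ N := by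
    intro p hp
    obtain ⟨X, hX, hpX⟩ := p.exists_le_maximal hp.ne_top
    have hX' : X ∈ ({U, M, N} : Set (Ideal R)) := hset ▸ hX
    rcases hX' with rfl | rfl | rfl
    exacts [Or.inl hpX, Or.inr (Or.inl hpX), Or.inr (Or.inr hpX)]
  have hPU : P ≤ U := by
    rcases le_or P hc.prime_left₁ with h | h | h
    exacts [h, absurd h hc.incomp₁₁.1, absurd h hc.incomp₁₂.1]
  refine ⟨‹_›, hcard, M, N, U, hM, hN, hU, hc.ne_right, hUM.symm, hUN.symm,
    ⟨P, ⟨⟨hc.prime_left₁, hP⟩, hc.incomp₁₁.1, hc.incomp₁₂.1⟩, ?_⟩, ?_⟩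
  · rintro P' ⟨hP', h1, h2⟩
    by_contra hne
    have hc' : IsCrossPair P P' M N :=
      ⟨hc.prime_left₁, hP'.1, hc.prime_right₁, hc.prime_right₂, Ne.symm hne, hc.ne_right,
        hc.incomp₁₁, hc.incomp₁₂, ⟨h1, hP'.not_maximal_le hM⟩, ⟨h2, hP'.not_maximal_le hN⟩⟩
    rcases hcov _ _ _ _ hc' U hU with e | e | e | e
    exacts [hP (e ▸ hU), hP'.2 (e ▸ hU), hUM e, hUN e]
  · intro Q hQ
    by_contra hQU
    have key : ∀ {X Y : Ideal R}, X.IsMaximal → Y.IsMaximal → X ≠ Y → U ≠ X → U ≠ Y → Q ≤ X →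
        ¬ P ≤ X → False := by
      intro X Y hX hY hXY hUX hUY hQX hPX
      have hc' : IsCrossPair P U Q X :=
        ⟨hc.prime_left₁, hc.prime_left₂, hQ.1, hX.isPrime, hc.ne_left, fun e => hQ.2 (e ▸ hX),
          incomparable_of_le_of_not_le hPU hPX hQX hQU,
          ⟨hPX, IsNonMaximalPrime.not_maximal_le ⟨hc.prime_left₁, hP⟩ hX⟩,
          ⟨hQ.not_maximal_le hU, hQU⟩, hU.incomparable hX hUX⟩
      rcases hcov _ _ _ _ hc' Y hY with e | e | e | e
      exacts [hP (e ▸ hY), hUY e.symm, hQ.2 (e ▸ hY), hXY e.symm]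
    rcases le_or Q hQ.1 with h | h | h
    exacts [hQU h, key hM hN hc.ne_right hUM hUN h hc.incomp₁₁.1,
      key hN hM hc.ne_right.symm hUN hUM h hc.incomp₁₂.1]

variable [IsDomain R] [IsBezout R]

theorem not_le_of_incomparable {P Q N : Ideal R} (hP : P.IsPrime) (hQ : Q.IsPrime)
    (hN : N.IsPrime) (h : ¬ P ≤ Q ∧ ¬ Q ≤ P) (hQN : Q ≤ N) : ¬ P ≤ N := fun hPN =>
  (IsBezout.le_or_le_of_le hP hQ hN hPN hQN).elim h.1 h.2

theorem CrossPairsCoverMaximals.exists_ncard (h : CrossPairsCoverMaximals R) :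
    {M : Ideal R | M.IsMaximal}.ncard = 2 ∨ {M : Ideal R | M.IsMaximal}.ncard = 3 ∨
      {M : Ideal R | M.IsMaximal}.ncard = 4 := by
  obtain ⟨⟨p₁, p₂, q₁, q₂, hc⟩, hcov⟩ := h
  have hsub : {M : Ideal R | M.IsMaximal} ⊆ {p₁, p₂, q₁, q₂} := fun M hM => hcov _ _ _ _ hc M hM
  have hfin : {M : Ideal R | M.IsMaximal}.Finite := (Set.toFinite _).subset hsub
  have h4 := Set.ncard_le_ncard hsub (Set.toFinite _)
  rw [hc.ncard_eq_four] at h4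
  obtain ⟨M, hM, hpM⟩ := p₁.exists_le_maximal hc.prime_left₁.ne_top
  obtain ⟨N, hN, hqN⟩ := q₁.exists_le_maximal hc.prime_right₁.ne_top
  have hMN : M ≠ N := by
    rintro rfl
    exact not_le_of_incomparable hc.prime_left₁ hc.prime_right₁ hM.isPrime hc.incomp₁₁ hqN hpM
  have h2 : ({M, N} : Set (Ideal R)).ncard ≤ {M : Ideal R | M.IsMaximal}.ncard := by
    refine Set.ncard_le_ncard ?_ hfin
    rintro X (rfl | rfl) <;> assumption
  rw [Set.ncard_pair hMN] at h2
  omega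

/-- Two maximal members on one side would leave no maximal ideal above the other side, so each side
has a non-maximal prime. Replacing a maximal member by a different candidate for $P$ or $Q$ produces
a cross pair that misses that maximal ideal. -/
theorem CrossPairsCoverMaximals.bezoutTwoMaximal (h : CrossPairsCoverMaximals R)
    (hcard : {M : Ideal R | M.IsMaximal}.ncard = 2) : BezoutTwoMaximal R := by
  obtain ⟨⟨p₁, p₂, q₁, q₂, hc⟩, hcov⟩ := h
  have hfin : {M : Ideal R | M.IsMaximal}.Finite := Set.finite_of_ncard_ne_zero (by omega)
  have eq_pair : ∀ {A B : Ideal R}, A.IsMaximal → B.IsMaximal → A ≠ B →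
      ∀ X : Ideal R, X.IsMaximal → X = A ∨ X = B := by
    intro A B hA hB hAB X hX
    have : ({A, B} : Set (Ideal R)) = {M : Ideal R | M.IsMaximal} := by
      refine Set.eq_of_subset_of_ncard_le ?_ (by rw [hcard, Set.ncard_pair hAB]) hfin
      rintro X (rfl | rfl) <;> assumption
    have hX' : X ∈ ({A, B} : Set (Ideal R)) := this ▸ hX
    simpa using hX'
  have left : ∀ {p₁ p₂ q₁ q₂ : Ideal R}, IsCrossPair p₁ p₂ q₁ q₂ → ¬ p₁.IsMaximal ∨
      ¬ p₂.IsMaximal := by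
    intro p₁ p₂ q₁ q₂ hc
    by_contra! hmax
    obtain ⟨X, hX, hqX⟩ := q₁.exists_le_maximal hc.prime_right₁.ne_top
    rcases eq_pair hmax.1 hmax.2 hc.ne_left X hX with rfl | rfl
    · exact hc.incomp₁₁.2 hqX
    · exact hc.incomp₂₁.2 hqX
  obtain ⟨P, M, Q, N, hc, hP, hQ⟩ : ∃ P M Q N : Ideal R, IsCrossPair P M Q N ∧ ¬ P.IsMaximal ∧
      ¬ Q.IsMaximal := by
    rcases left hc with hp | hp <;> rcases left hc.swap with hq | hq
    exacts [⟨_, _, _, _, hc, hp, hq⟩, ⟨_, _, _, _, hc.swap_right, hp, hq⟩,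
      ⟨_, _, _, _, hc.swap_left, hp, hq⟩, ⟨_, _, _, _, hc.swap_left.swap_right, hp, hq⟩]
  have hMN : M ≠ N := fun e => hc.incomp₂₂.1 e.le
  have hset : {M : Ideal R | M.IsMaximal} = {M, N} := by
    refine Set.eq_of_subset_of_ncard_le ?_ (by rw [hcard, Set.ncard_pair hMN])
    intro X hX
    rcases hcov _ _ _ _ hc X hX with rfl | rfl | rfl | rfl
    exacts [absurd hX hP, by simp, absurd hX hQ, by simp]
  have hM : M.IsMaximal := (hset ▸ (by simp : M ∈ ({M, N} : Set (Ideal R))) :)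
  have hN : N.IsMaximal := (hset ▸ (by simp : N ∈ ({M, N} : Set (Ideal R))) :)
  have le_or : ∀ p : Ideal R, p.IsPrime → p ≤ M ∨ p ≤ N := by
    intro p hp
    obtain ⟨X, hX, hpX⟩ := p.exists_le_maximal hp.ne_top
    rcases eq_pair hM hN hMN X hX with rfl | rfl
    exacts [Or.inl hpX, Or.inr hpX]
  have hPM : P ≤ M := (le_or P hc.prime_left₁).resolve_right hc.incomp₁₂.1
  have hQN : Q ≤ N := (le_or Q hc.prime_right₁).resolve_left hc.incomp₂₁.2
  have uniq : ∀ P' Q' : Ideal R, IsNonMaximalPrime P' → IsNonMaximalPrime Q' → ¬ P' ≤ Q' →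
      ¬ Q' ≤ P' → P' ≤ M → Q' ≤ N → P' = P ∧ Q' = Q := by
    intro P' Q' hP' hQ' h1 h2 hPM' hQN'
    have hPN' := not_le_of_incomparable hP'.1 hQ'.1 hN.isPrime ⟨h1, h2⟩ hQN'
    have hQM' := not_le_of_incomparable hQ'.1 hP'.1 hM.isPrime ⟨h2, h1⟩ hPM'
    constructor
    · by_contra hne
      have hc' : IsCrossPair P P' Q N :=
        ⟨hc.prime_left₁, hP'.1, hc.prime_right₁, hc.prime_right₂, Ne.symm hne, hc.ne_right,
          hc.incomp₁₁, hc.incomp₁₂, incomparable_of_le_of_not_le hPM' hPN' hQN hc.incomp₂₁.2,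
          hPN', hP'.not_maximal_le hN⟩
      rcases hcov _ _ _ _ hc' M hM with e | e | e | e
      exacts [hP (e ▸ hM), hP'.2 (e ▸ hM), hQ (e ▸ hM), hMN e]
    · by_contra hne
      have hc' : IsCrossPair P M Q Q' :=
        ⟨hc.prime_left₁, hc.prime_left₂, hc.prime_right₁, hQ'.1, hc.ne_left, Ne.symm hne,
          hc.incomp₁₁, incomparable_of_le_of_not_le hPM hc.incomp₁₂.1 hQN' hQM', hc.incomp₂₁,
          hQ'.not_maximal_le hM, hQM'⟩
      rcases hcov _ _ _ _ hc' N hN with e | e | e | e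
      exacts [hP (e ▸ hN), hMN e.symm, hQ (e ▸ hN), hQ'.2 (e ▸ hN)]
  refine ⟨‹_›, hcard, P, Q, ⟨hc.prime_left₁, hP⟩, ⟨hc.prime_right₁, hQ⟩, hc.incomp₁₁.1,
    hc.incomp₁₁.2, fun P' Q' hP' hQ' h1 h2 => ?_⟩
  rcases le_or P' hP'.1 with hPM' | hPN' <;> rcases le_or Q' hQ'.1 with hQM' | hQN'
  · exact absurd hPM' (not_le_of_incomparable hP'.1 hQ'.1 hM.isPrime ⟨h1, h2⟩ hQM')
  · exact Or.inl (uniq P' Q' hP' hQ' h1 h2 hPM' hQN')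
  · exact Or.inr (uniq Q' P' hQ' hP' h2 h1 hQM' hPN').symm
  · exact absurd hPN' (not_le_of_incomparable hP'.1 hQ'.1 hN.isPrime ⟨h1, h2⟩ hQN')

theorem CrossPairsCoverMaximals.bezoutFourMaximal (h : CrossPairsCoverMaximals R)
    (hcard : {M : Ideal R | M.IsMaximal}.ncard = 4) : BezoutFourMaximal R := by
  obtain ⟨-, hcov⟩ := h
  have hfin : {M : Ideal R | M.IsMaximal}.Finite := Set.finite_of_ncard_ne_zero (by omega)
  -- A non-maximal prime avoids at most one maximal ideal: otherwise $P,X;M,N$ with $X$ above $P$ is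
  -- a cross pair with only three maximal members.
  have only : ∀ {P M N : Ideal R}, IsNonMaximalPrime P → M.IsMaximal → N.IsMaximal → ¬ P ≤ M →
      ¬ P ≤ N → M = N := by
    intro P M N hP hM hN hPM hPN
    by_contra hMN
    obtain ⟨X, hX, hPX, hne⟩ := hP.exists_le_maximal
    have hc : IsCrossPair P X M N :=
      ⟨hP.1, hX.isPrime, hM.isPrime, hN.isPrime, hne, hMN, ⟨hPM, hP.not_maximal_le hM⟩,
        ⟨hPN, hP.not_maximal_le hN⟩, hX.incomparable hM (fun e => hPM (e ▸ hPX)),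
        hX.incomparable hN (fun e => hPN (e ▸ hPX))⟩
    have hsub : {M : Ideal R | M.IsMaximal} ⊆ {X, M, N} := by
      intro Y hY
      rcases hcov _ _ _ _ hc Y hY with rfl | rfl | rfl | rfl
      exacts [absurd hY hP.2, by simp, by simp, by simp]
    have h1 := Set.ncard_le_ncard hsub (Set.toFinite _)
    have h2 := Set.ncard_insert_le X ({M, N} : Set (Ideal R))
    rw [Set.ncard_pair hMN] at h2
    omega
  refine ⟨‹_›, hcard, ?_⟩
  rintro M ⟨hM, hM'⟩ N ⟨hN, hN'⟩
  push Not at hM' hN'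
  obtain ⟨P, hP, hPM⟩ := hM'
  obtain ⟨Q, hQ, hQN⟩ := hN'
  by_contra hMN
  obtain ⟨X, hX, hX'⟩ : ∃ X ∈ {M : Ideal R | M.IsMaximal}, X ∉ ({M, N} : Set (Ideal R)) :=
    Set.exists_mem_notMem_of_ncard_lt_ncard (by rw [Set.ncard_pair hMN, hcard]; omega)
      (Set.toFinite _)
  simp only [Set.mem_insert_iff, Set.mem_singleton_iff, not_or] at hX'
  have hPX : P ≤ X := by
    by_contra h
    exact hX'.1 (only hP hX hM h hPM)
  have hQX : Q ≤ X := by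
    by_contra h
    exact hX'.2 (only hQ hX hN h hQN)
  -- Below the common $X$ the two primes are comparable, and the larger one avoids both $M$ and $N$.
  rcases IsBezout.le_or_le_of_le hP.1 hQ.1 hX.isPrime hPX hQX with h | h
  · exact hMN (only hQ hM hN (fun h' => hPM (h.trans h')) hQN)
  · exact hMN (only hP hM hN hPM fun h' => hQN (h.trans h'))

end Combinatorics

/-! ### From the three configurations back to covering cross pairs -/

section Converse

variable {R : Type*} [CommRing R] [IsDomain R]

theorem BezoutTwoMaximal.crossPairsCoverMaximals (h : BezoutTwoMaximal R) :
    CrossPairsCoverMaximals R := by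
  obtain ⟨hB, hcard, P, Q, hP, hQ, hPQ, hQP, huniq⟩ := h
  obtain ⟨M, hM, hPM, hneP⟩ := hP.exists_le_maximal
  obtain ⟨N, hN, hQN, hneQ⟩ := hQ.exists_le_maximal
  have hPN := not_le_of_incomparable hP.1 hQ.1 hN.isPrime ⟨hPQ, hQP⟩ hQN
  have hQM := not_le_of_incomparable hQ.1 hP.1 hM.isPrime ⟨hQP, hPQ⟩ hPM
  have hMN : M ≠ N := fun e => hPN (e ▸ hPM)
  refine ⟨⟨P, M, Q, N, hP.1, hM.isPrime, hQ.1, hN.isPrime, hneP, hneQ, ⟨hPQ, hQP⟩,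
    ⟨hPN, hP.not_maximal_le hN⟩, ⟨hQ.not_maximal_le hM, hQM⟩, hM.incomparable hN hMN⟩, ?_⟩
  intro p₁ p₂ q₁ q₂ hc X hX
  by_contra! hne
  obtain ⟨Y, hY⟩ : ∃ Y : Ideal R, ∀ Z : Ideal R, Z.IsMaximal → Z ≠ X → Z = Y := by
    obtain ⟨A, B, -, hset⟩ := Set.ncard_eq_two.mp hcard
    have mem : ∀ Z : Ideal R, Z.IsMaximal → Z = A ∨ Z = B := by
      intro Z hZ
      have : Z ∈ ({A, B} : Set (Ideal R)) := hset ▸ hZ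
      simpa using this
    rcases mem X hX with rfl | rfl
    · exact ⟨B, fun Z hZ hne => (mem Z hZ).resolve_left hne⟩
    · exact ⟨A, fun Z hZ hne => (mem Z hZ).resolve_right hne⟩
  -- A cross pair missing $X$ has at most one maximal member, so some non-maximal prime is
  -- incomparable to two distinct others, against the uniqueness of the pair.
  have key : ∀ {a b c : Ideal R}, IsNonMaximalPrime a → IsNonMaximalPrime b →
      IsNonMaximalPrime c → (¬ a ≤ c ∧ ¬ c ≤ a) → (¬ b ≤ c ∧ ¬ c ≤ b) → a = b := by
    intro a b c ha hb hc hac hbc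
    have hne : P ≠ Q := fun e => hPQ e.le
    rcases huniq a c ha hc hac.1 hac.2 with ⟨h1, h2⟩ | ⟨h1, h2⟩ <;>
      rcases huniq b c hb hc hbc.1 hbc.2 with ⟨h3, h4⟩ | ⟨h3, h4⟩
    · exact h1.trans h3.symm
    · exact absurd (h4.symm.trans h2) hne
    · exact absurd (h2.symm.trans h4) hne
    · exact h1.trans h3.symm
  have pair : ∀ {p₁ p₂ q₁ q₂ : Ideal R}, IsCrossPair p₁ p₂ q₁ q₂ → X ≠ q₁ → X ≠ q₂ →
      ¬ p₁.IsMaximal → ¬ p₂.IsMaximal → False := by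
    intro p₁ p₂ q₁ q₂ hc h1 h2 hp₁ hp₂
    by_cases hq₁ : q₁.IsMaximal
    · have hq₂ : ¬ q₂.IsMaximal := fun hq₂ =>
        hc.ne_right ((hY _ hq₁ h1.symm).trans (hY _ hq₂ h2.symm).symm)
      exact hc.ne_left (key ⟨hc.prime_left₁, hp₁⟩ ⟨hc.prime_left₂, hp₂⟩ ⟨hc.prime_right₂, hq₂⟩
        hc.incomp₁₂ hc.incomp₂₂)
    · exact hc.ne_left (key ⟨hc.prime_left₁, hp₁⟩ ⟨hc.prime_left₂, hp₂⟩ ⟨hc.prime_right₁, hq₁⟩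
        hc.incomp₁₁ hc.incomp₂₁)
  have not_both : ∀ {a b : Ideal R}, X ≠ a → X ≠ b → (¬ a ≤ b ∧ ¬ b ≤ a) → a.IsMaximal →
      ¬ b.IsMaximal := fun h1 h2 h ha hb =>
    h.1 ((hY _ ha h1.symm).trans (hY _ hb h2.symm).symm).le
  obtain ⟨n1, n2, n3, n4⟩ := hne
  by_cases hp₁ : p₁.IsMaximal
  · exact pair hc.swap n1 n2 (not_both n1 n3 hc.incomp₁₁ hp₁) (not_both n1 n4 hc.incomp₁₂ hp₁)
  by_cases hp₂ : p₂.IsMaximal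
  · exact pair hc.swap n1 n2 (not_both n2 n3 hc.incomp₂₁ hp₂) (not_both n2 n4 hc.incomp₂₂ hp₂)
  exact pair hc n3 n4 hp₁ hp₂

theorem BezoutThreeMaximal.crossPairsCoverMaximals (h : BezoutThreeMaximal R) :
    CrossPairsCoverMaximals R := by
  obtain ⟨hB, hcard, M, N, U, hM, hN, hU, hMN, hMU, hNU, ⟨P, ⟨hP, hPM, hPN⟩, huniq⟩, hall⟩ := h
  have hfin : {M : Ideal R | M.IsMaximal}.Finite := Set.finite_of_ncard_ne_zero (by omega)
  refine ⟨⟨P, U, M, N, hP.1, hU.isPrime, hM.isPrime, hN.isPrime,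
    fun e => hP.2 (e ▸ hU), hMN, ⟨hPM, hP.not_maximal_le hM⟩, ⟨hPN, hP.not_maximal_le hN⟩,
    hU.incomparable hM hMU.symm, hU.incomparable hN hNU.symm⟩, ?_⟩
  have hset : ({M, N, U} : Set (Ideal R)) = {M : Ideal R | M.IsMaximal} := by
    refine Set.eq_of_subset_of_ncard_le ?_ ?_ hfin
    · rintro X (rfl | rfl | rfl) <;> assumption
    · rw [hcard, Set.ncard_insert_of_notMem (by simp [hMN, hMU]) (Set.toFinite _),
        Set.ncard_pair hNU]
  have mem : ∀ Z : Ideal R, Z.IsMaximal → Z = M ∨ Z = N ∨ Z = U := by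
    intro Z hZ
    have : Z ∈ ({M, N, U} : Set (Ideal R)) := hset ▸ hZ
    simpa using this
  intro p₁ p₂ q₁ q₂ hc X hX
  suffices hX' : X ∈ ({p₁, p₂, q₁, q₂} : Set (Ideal R)) by simpa using hX'
  rcases hc.maximal_or_exists with ⟨h1, h2, h3, h4⟩ | ⟨a₁, a₂, b₁, b₂, h, ha₁, hset'⟩
  · have := Set.ncard_le_ncard (s := {p₁, p₂, q₁, q₂}) (by
      rintro X (rfl | rfl | rfl | rfl) <;> assumption) hfin
    rw [hc.ncard_eq_four] at this
    omega
  rw [← hset']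
  have ha₁' : IsNonMaximalPrime a₁ := ⟨h.prime_left₁, ha₁⟩
  have haU := hall _ ha₁'
  -- A prime incomparable to `a₁` cannot lie below $U$, where the primes form a chain. Hence it is
  -- maximal and equals $M$ or $N$; uniqueness of $P$ then forces `a₂` to be $U$.
  have right : ∀ b : Ideal R, b.IsPrime → (¬ a₁ ≤ b ∧ ¬ b ≤ a₁) → b = M ∨ b = N := by
    intro b hb hinc
    have hbU := not_le_of_incomparable hb ha₁'.1 hU.isPrime hinc.symm haU
    have hbm : b.IsMaximal := by
      by_contra hbm
      exact hbU (hall b ⟨hb, hbm⟩)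
    rcases mem b hbm with e | e | e
    exacts [Or.inl e, Or.inr e, absurd e.le hbU]
  have hMNmem : (M = b₁ ∨ M = b₂) ∧ (N = b₁ ∨ N = b₂) := by
    have hne := h.ne_right
    rcases right b₁ h.prime_right₁ h.incomp₁₁ with e | e <;>
      rcases right b₂ h.prime_right₂ h.incomp₁₂ with e' | e'
    · exact absurd (e.trans e'.symm) hne
    · exact ⟨Or.inl e.symm, Or.inr e'.symm⟩
    · exact ⟨Or.inr e'.symm, Or.inl e.symm⟩
    · exact absurd (e.trans e'.symm) hne
  have inc : ∀ a : Ideal R, (¬ a ≤ b₁ ∧ ¬ b₁ ≤ a) → (¬ a ≤ b₂ ∧ ¬ b₂ ≤ a) → ¬ a ≤ M ∧ ¬ a ≤ N := by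
    intro a h1 h2
    obtain ⟨e | e, e' | e'⟩ := hMNmem <;> rw [e, e']
    exacts [⟨h1.1, h1.1⟩, ⟨h1.1, h2.1⟩, ⟨h2.1, h1.1⟩, ⟨h2.1, h2.1⟩]
  have hi₁ := inc a₁ h.incomp₁₁ h.incomp₁₂
  have hi₂ := inc a₂ h.incomp₂₁ h.incomp₂₂
  have ha₂ : a₂.IsMaximal := by
    by_contra ha₂
    exact h.ne_left ((huniq a₁ ⟨ha₁', hi₁⟩).trans (huniq a₂ ⟨⟨h.prime_left₂, ha₂⟩, hi₂⟩).symm)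
  have ha₂U : a₂ = U := by
    rcases mem a₂ ha₂ with e | e | e
    exacts [absurd e.le hi₂.1, absurd e.le hi₂.2, e]
  simp only [Set.mem_insert_iff, Set.mem_singleton_iff]
  rcases mem X hX with rfl | rfl | rfl
  · exact Or.inr (Or.inr hMNmem.1)
  · exact Or.inr (Or.inr hMNmem.2)
  · exact Or.inr (Or.inl ha₂U.symm)

theorem BezoutFourMaximal.crossPairsCoverMaximals (h : BezoutFourMaximal R) :
    CrossPairsCoverMaximals R := by
  obtain ⟨hB, hcard, hsub⟩ := h
  have hfin : {M : Ideal R | M.IsMaximal}.Finite := Set.finite_of_ncard_ne_zero (by omega)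
  constructor
  · obtain ⟨A, B, C, D, hAB, hAC, hAD, hBC, hBD, hCD, hset⟩ := Set.ncard_eq_four.mp hcard
    have hmax : ∀ X ∈ ({A, B, C, D} : Set (Ideal R)), X.IsMaximal := fun X hX =>
      (hset ▸ hX : X ∈ {M : Ideal R | M.IsMaximal})
    have hA := hmax A (by simp)
    have hB' := hmax B (by simp)
    have hC := hmax C (by simp)
    have hD := hmax D (by simp)
    exact ⟨A, B, C, D, hA.isPrime, hB'.isPrime, hC.isPrime, hD.isPrime, hAB, hCD,
      hA.incomparable hC hAC, hA.incomparable hD hAD, hB'.incomparable hC hBC,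
      hB'.incomparable hD hBD⟩
  · intro p₁ p₂ q₁ q₂ hc X hX
    rcases hc.maximal_or_exists with ⟨h1, h2, h3, h4⟩ | ⟨a₁, a₂, b₁, b₂, h, ha₁, -⟩
    · have hset : ({p₁, p₂, q₁, q₂} : Set (Ideal R)) = {M : Ideal R | M.IsMaximal} := by
        refine Set.eq_of_subset_of_ncard_le ?_ (by rw [hcard, hc.ncard_eq_four]) hfin
        rintro X (rfl | rfl | rfl | rfl) <;> assumption
      have : X ∈ ({p₁, p₂, q₁, q₂} : Set (Ideal R)) := hset ▸ hX
      simpa using this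
    exfalso
    have ha₁' : IsNonMaximalPrime a₁ := ⟨h.prime_left₁, ha₁⟩
    obtain ⟨N₁, hN₁, hb₁⟩ := b₁.exists_le_maximal h.prime_right₁.ne_top
    obtain ⟨N₂, hN₂, hb₂⟩ := b₂.exists_le_maximal h.prime_right₂.ne_top
    have hn₁ := not_le_of_incomparable ha₁'.1 h.prime_right₁ hN₁.isPrime h.incomp₁₁ hb₁
    have hn₂ := not_le_of_incomparable ha₁'.1 h.prime_right₂ hN₂.isPrime h.incomp₁₂ hb₂
    have fails : ∀ {Y P : Ideal R}, Y.IsMaximal → IsNonMaximalPrime P → ¬ P ≤ Y →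
        Y ∈ {M : Ideal R | M.IsMaximal ∧ ¬ ∀ P : Ideal R, IsNonMaximalPrime P → P ≤ M} :=
      fun hY hP hPY => ⟨hY, fun hall => hPY (hall _ hP)⟩
    -- Both maximal ideals avoid `a₁`, so they coincide. Then `b₁` and `b₂` are comparable, the
    -- smaller is not maximal, and it avoids the maximal ideal above `a₁`, which is thus a second
    -- exception.
    obtain rfl := hsub (fails hN₁ ha₁' hn₁) (fails hN₂ ha₁' hn₂)
    obtain ⟨M, hM, haM, -⟩ := ha₁'.exists_le_maximal
    have key : ∀ b : Ideal R, IsNonMaximalPrime b → (¬ a₁ ≤ b ∧ ¬ b ≤ a₁) → False := by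
      intro b hb hinc
      have hbM := not_le_of_incomparable hb.1 ha₁'.1 hM.isPrime hinc.symm haM
      obtain rfl := hsub (fails hN₁ ha₁' hn₁) (fails hM hb hbM)
      exact hn₁ haM
    rcases IsBezout.le_or_le_of_le h.prime_right₁ h.prime_right₂ hN₁.isPrime hb₁ hb₂ with hle | hle
    · exact key b₁ ⟨h.prime_right₁, fun hb =>
        h.ne_right (hb.eq_of_le h.prime_right₂.ne_top hle)⟩ h.incomp₁₁
    · exact key b₂ ⟨h.prime_right₂, fun hb =>
        h.ne_right (hb.eq_of_le h.prime_right₁.ne_top hle).symm⟩ h.incomp₁₂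

end Converse

theorem IsMaximalNonValuativeDomain.isBezout {R : Type*} [CommRing R] [IsDomain R]
    [IsIntegrallyClosed R] (h : IsMaximalNonValuativeDomain R) : IsBezout R :=
  (locallyTotalDvd_of_overrings_valuative h.2.2).isBezout
    (finite_setOf_isMaximal_of_overrings_valuative h.2.2)

theorem theorem2p9 (R : Type*) [CommRing R] [IsDomain R] [IsIntegrallyClosed R] :
    IsMaximalNonValuativeDomain R ↔
      ExactlyOneOfThree (BezoutTwoMaximal R) (BezoutThreeMaximal R) (BezoutFourMaximal R) := by
  constructor
  · intro h
    have := h.isBezout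
    have hc := (IsBezout.isMaximalNonValuativeDomain_iff R).mp h
    -- The three cases have different numbers of maximal ideals, so they exclude one another.
    rcases hc.exists_ncard with hn | hn | hn
    · exact Or.inl ⟨hc.bezoutTwoMaximal hn, fun h => by have := h.2.1; omega,
        fun h => by have := h.2.1; omega⟩
    · exact Or.inr (Or.inl ⟨fun h => by have := h.2.1; omega, hc.bezoutThreeMaximal hn,
        fun h => by have := h.2.1; omega⟩)
    · exact Or.inr (Or.inr ⟨fun h => by have := h.2.1; omega, fun h => by have := h.2.1; omega,
        hc.bezoutFourMaximal hn⟩)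
  · rintro (⟨h, -, -⟩ | ⟨-, h, -⟩ | ⟨-, -, h⟩)
    all_goals
      have := h.1
      exact (IsBezout.isMaximalNonValuativeDomain_iff R).mpr h.crossPairsCoverMaximals
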